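/- Let $d,m\ge 1$ be integers and $T>0$. Let $\mathcal P_1(\mathbb R^d)$ be the set of Borel probability measures on $\mathbb R^d$ with finite first moment, let $$\mathcal W_1(\mu,\nu)=\inf_{\pi}\int_{\mathbb R^d\times\mathbb R^d}|x-y|\,d\pi(x,y)$$ be the Wasserstein distance (infimum over all couplings $\pi$ of $\mu$ and $\nu$), let $\chi=\mathbb R^{dm}\times\mathcal P_1(\mathbb R^d)$, and write $$\|(Y,\mu)-(Y',\mu')\|_\chi:=\frac1m\sum_{k=1}^m|Y_k-Y'_k|+\mathcal W_1(\mu,\mu').$$ Let $H,G^1,\dots,G^d:\mathbb R^d\to\mathbb R^d$ be locally Lipschitz with sublinear growth, i.e. $|H(\xi)|\le C_H(1+|\xi|)$ and $|G^\ell(\xi)|\le C_{G^\ell}(1+|\xi|)$ for all $\xi$, and let $\mathcal U\subset\mathbb R^{md}$ be nonempty and compact. For $u=(u_1,\dots,u_m)\in L^\infty([0,T],\mathcal U)$, with $u_k=(u_{k1},\dots,u_{kd})$, consider the system $$\dot Y_k=u_k\ (k=1,\dots,m),\qquad \partial_t\mu+\nabla\cdot\Bigl[\Bigl(H*\mu+\sum_{\ell=1}^d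 G^\ell*\mu_{m\ell}\Bigr)\mu\Bigr]=0,\qquad \mu_{m\ell}=\frac1m\sum_{k=1}^m u_{k\ell}\,\delta_{Y_k}.$$ A solution with initial datum $(Y^0,\mu^0)\in\chi$ is a map $(Y,\mu):[0,T]\to\chi$ with $(Y(0),\mu(0))=(Y^0,\mu^0)$ such that: there is $R'>0$ with $\operatorname{supp}\mu(t)\subset \overline{B}(0,R')$ for all $t\in[0,T]$; $(Y,\mu)$ is continuous on $[0,T]$ for the $\chi$-distance; $Y_k(t)=Y_k(0)+\int_0^t u_k(s)\,ds$ for all $t\in[0,T]$ and all $k$; and, for every $\varphi\in C_c^\infty(\mathbb R^d)$ and every $t\in[0,T]$, $$\int\varphi\,d\mu(t)=\int\varphi\,d\mu(0)+\int_0^t\int\nabla\varphi(x)\cdot\Bigl(H*\mu(s)(x)+\sum_{\ell=1}^d G^\ell*\mu_{m\ell}(s)(x)\Bigr)d\mu(s)(x)\,ds.$$ Then for every $R$ there exists a constant $C_T>0$, depending only on $d,m,T,H,G^1,\dots,G^d,\mathcal U$ and $R$, such that the following holds. Let $u\in L^\infty([0,T],\mathcal U)$ and let $(Y^1,\mu^1)$,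 $(Y^2,\mu^2)$ be two solutions for the same control $u$ with initial data $(Y^{0,i},\mu^{0,i})\in\chi$ satisfying $|Y^{0,i}_k|\le R$ for all $k$ and $\operatorname{supp}\mu^{0,i}\subset\overline{B}(0,R)$, $i=1,2$. Then $$\|(Y^1(t),\mu^1(t))-(Y^2(t),\mu^2(t))\|_\chi\le C_T\,\|(Y^{0,1},\mu^{0,1})-(Y^{0,2},\mu^{0,2})\|_\chi\qquad\text{for all }t\in[0,T].$$ (Any two compactly supported initial measures, with any leader positions, satisfy the condition for some $R$.) -/

import Mathlib

open MeasureTheory Filter Topology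

noncomputable section

namespace LeaderFollower

/-- Euclidean space `ℝ^d`, with its Euclidean norm. -/
abbrev E (d : ℕ) : Type := EuclideanSpace ℝ (Fin d)

/-- `𝒫₁(ℝ^d)`: Borel probability measures on `ℝ^d` with finite first moment. -/
def P1 (d : ℕ) : Type :=
  {μ : Measure (E d) // IsProbabilityMeasure μ ∧ Integrable (fun x : E d => ‖x‖) μ}

/-- The transport plans `Π(μ, ν)`: measures on the product with marginals `μ` and `ν`. -/
def couplings {d : ℕ} (μ ν : P1 d) : Set (Measure (E d × E d)) :=
  {π | π.map Prod.fst = μ.1 ∧ π.map Prod.snd = ν.1}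

/-- The Wasserstein distance `𝒲₁(μ, ν) = inf_π ∫ |x - y| dπ(x, y)`.
For `μ, ν ∈ 𝒫₁` the set of plans is nonempty and `|x - y|` is integrable for each plan. -/
def W1 {d : ℕ} (μ ν : P1 d) : ℝ :=
  sInf ((fun π : Measure (E d × E d) => ∫ z, ‖z.1 - z.2‖ ∂π) '' couplings μ ν)

/-- The state space `χ = (ℝ^d)^m × 𝒫₁(ℝ^d)`. -/
abbrev Chi (d m : ℕ) : Type := (Fin m → E d) × P1 d

/-- The `χ`-distance: mean distance of the leaders plus the Wasserstein distance. -/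
def chiDist {d m : ℕ} (p q : Chi d m) : ℝ :=
  (1 / (m : ℝ)) * ∑ k, ‖p.1 k - q.1 k‖ + W1 p.2 q.2

/-- Sublinear growth: `|F(ξ)| ≤ C (1 + |ξ|)`. -/
def SublinearGrowth {d : ℕ} (F : E d → E d) : Prop :=
  ∃ C : ℝ, ∀ ξ, ‖F ξ‖ ≤ C * (1 + ‖ξ‖)

/-- The convolution `(H * μ)(x) = ∫ H(x - y) dμ(y)`. -/
def conv {d : ℕ} (H : E d → E d) (μ : P1 d) (x : E d) : E d :=
  ∫ y, H (x - y) ∂μ.1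

/-- The convolution `(F * μ_{m,ℓ})(x)` with the signed atomic measure
`μ_{m,ℓ} = (1/m) ∑ₖ u_{k,ℓ} δ_{Y_k}`; here `u k ℓ` is the `ℓ`-th coordinate of `u_k`. -/
def convLeaders {d m : ℕ} (F : E d → E d) (ℓ : Fin d) (u Y : Fin m → E d) (x : E d) : E d :=
  (1 / (m : ℝ)) • ∑ k, u k ℓ • F (x - Y k)

/-- The velocity of the followers: `H * μ + ∑_ℓ G^ℓ * μ_{m,ℓ}`. -/
def velocity {d m : ℕ} (H : E d → E d) (G : Fin d → E d → E d) (u : Fin m → E d)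
    (p : Chi d m) (x : E d) : E d :=
  conv H p.2 x + ∑ ℓ, convLeaders (G ℓ) ℓ u p.1 x

/-- `u ∈ L^∞([0,T], 𝒰)`. -/
def IsControl {d m : ℕ} (T : ℝ) (𝒰 : Set (Fin m → E d)) (u : ℝ → Fin m → E d) : Prop :=
  MemLp u ⊤ (volume.restrict (Set.Icc 0 T)) ∧
    ∀ᵐ t ∂(volume.restrict (Set.Icc 0 T)), u t ∈ 𝒰

/-- `(Y, μ) : [0,T] → χ` solves `Ẏ_k = u_k`, `∂ₜμ + ∇·((H * μ + ∑_ℓ G^ℓ * μ_{m,ℓ}) μ) = 0`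
with control `u` and initial datum `p₀`. As `u` is only measurable in time, both equations are
understood in the Carathéodory sense, i.e. in time-integrated form. Only the values of `ζ` on
`[0,T]` matter. -/
structure IsSolution {d m : ℕ} (T : ℝ) (H : E d → E d) (G : Fin d → E d → E d)
    (u : ℝ → Fin m → E d) (p₀ : Chi d m) (ζ : ℝ → Chi d m) : Prop where
  /-- the initial condition -/
  initial : ζ 0 = p₀
  /-- `μ` is equi-compactly supported in time -/
  equicompact : ∃ R > 0, ∀ t ∈ Set.Icc 0 T, (ζ t).2.1.support ⊆ Metric.closedBall 0 R
  /-- continuity in time for the `χ`-distance -/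
  continuous : ∀ t ∈ Set.Icc 0 T,
    Tendsto (fun s => chiDist (ζ s) (ζ t)) (𝓝[Set.Icc 0 T] t) (𝓝 0)
  /-- the leaders are a Carathéodory solution of `Ẏ_k = u_k` -/
  leaders : ∀ t ∈ Set.Icc 0 T, ∀ k, (ζ t).1 k = (ζ 0).1 k + ∫ s in (0 : ℝ)..t, u s k
  /-- the weak form of the continuity equation, for test functions in `C_c^∞(ℝ^d)` -/
  followers : ∀ φ : E d → ℝ, ContDiff ℝ ((⊤ : ℕ∞) : WithTop ℕ∞) φ → HasCompactSupport φ →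
    ∀ t ∈ Set.Icc 0 T,
      ∫ x, φ x ∂(ζ t).2.1 = ∫ x, φ x ∂(ζ 0).2.1 +
        ∫ s in (0 : ℝ)..t, ∫ x, inner ℝ (gradient φ x) (velocity H G (u s) (ζ s) x) ∂(ζ s).2.1

end LeaderFollower

end

open MeasureTheory Filter Topology

noncomputable section

namespace LeaderFollower

open scoped Convolution ContDiff

/-! Two facts carry the proof: a common ball confines all solutions issued from a given ball, and on
that ball the fields may be taken bounded and globally Lipschitz, so that a Gronwall estimate
applies.

Confinement (`exists_confinement`). Leaders have speed at most `U`, a bound for `𝒰`. Sublinear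
growth gives a velocity at most `A (1 + |x| + ∫|y| dμ)`. Testing the continuity equation with `1 +
|x|²` bounds the first moment; testing it with `(1 + |x|²)^(p+1)` gives growth at a rate linear in
`p + 1`, and `p → ∞` turns the moment bounds into a bound on the support. Only differences of points
of that ball enter the velocity, so composing `H` and `G ℓ` with the projection `clamp` changes
nothing and provides global constants `B`, `L`.

Stability (`chiDist_le_exp`). Put `Λ = L (1 + d U)`. The Wasserstein distance is computed by
Kantorovich-Rubinstein duality with smooth 1-Lipschitz test functions. No flow or superposition
principle is used: a test function is carried backward by explicit Euler steps `φ ↦ φ (x + h w x)`,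
where `w` is a mollification of the velocity frozen at the second solution, with time-averaged
control. The same `w` serves both solutions. A step multiplies the Lipschitz constant `a` of `φ` by
`1 + hΛ`, costs `a h Λ` times the distance of the solutions, and has a consistency error of order `h
ε + h²`. The mollification width is fixed while `h → 0`, and only afterwards does the remaining
error vanish.

Under a shared control the leader differences are constant. Hence a bound `S exp (3Λs)` for the
distance improves to `(D + S/2) exp (3Λt)`, where `D` is the initial distance, since `∫₀ᵗ Λ exp
(Λ(t-s)) S exp (3Λs) ds ≤ (S/2) exp (3Λt)`. Iterating the improvement leaves `2 D exp (3Λt)`. -/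

/-- `f` is Lipschitz with the real constant `L`. -/
def LipBound {X Y : Type*} [NormedAddCommGroup X] [NormedAddCommGroup Y] (L : ℝ) (f : X → Y) :
    Prop :=
  ∀ x y, ‖f x - f y‖ ≤ L * ‖x - y‖

/-! ### Lipschitz bounds with a real constant -/

namespace LipBound

variable {X Y : Type*} [NormedAddCommGroup X] [NormedAddCommGroup Y] {L : ℝ} {f : X → Y}

theorem mono {L' : ℝ} (hf : LipBound L f) (h : L ≤ L') : LipBound L' f := fun x y =>
  (hf x y).trans (by gcongr)

theorem toNNReal (hf : LipBound L f) : LipschitzWith L.toNNReal f :=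
  LipschitzWith.of_dist_le_mul fun x y => by
    rw [dist_eq_norm, dist_eq_norm]
    exact (hf x y).trans (by gcongr; exact Real.le_coe_toNNReal L)

theorem continuous (hf : LipBound L f) : Continuous f := hf.toNNReal.continuous

theorem norm_fderiv_le [NormedSpace ℝ X] [NormedSpace ℝ Y] (hL : 0 ≤ L) (hf : LipBound L f)
    (x : X) : ‖fderiv ℝ f x‖ ≤ L := by
  simpa [hL] using _root_.norm_fderiv_le_of_lipschitz ℝ hf.toNNReal (x₀ := x)

theorem of_norm_fderiv_le [NormedSpace ℝ X] [NormedSpace ℝ Y] (hf : Differentiable ℝ f)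
    (h : ∀ x, ‖fderiv ℝ f x‖ ≤ L) : LipBound L f := fun x y =>
  Convex.norm_image_sub_le_of_norm_fderiv_le (fun z _ => hf z) (fun z _ => h z) convex_univ
    (Set.mem_univ y) (Set.mem_univ x)

end LipBound

/-! ### Mollification with bounds uniform over Lipschitz functions -/

section Mollification

variable {X : Type*} [NormedAddCommGroup X] [NormedSpace ℝ X] [FiniteDimensional ℝ X]
  [MeasurableSpace X] [BorelSpace X]

/-- Convolution with a compactly supported kernel preserves Lipschitz bounds. -/
theorem LipBound.convolution {A F F' : Type*} [NormedAddCommGroup A] [NormedSpace ℝ A]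
    [NormedAddCommGroup F] [NormedSpace ℝ F] [NormedAddCommGroup F'] [NormedSpace ℝ F']
    (B : A →L[ℝ] F →L[ℝ] F') {μ : Measure X}
    [μ.IsAddHaarMeasure] {η : X → A} (hη : Continuous η) (hηc : HasCompactSupport η)
    {L : ℝ} {g : X → F} (hg : LipBound L g) :
    LipBound (‖B‖ * (∫ t, ‖η t‖ ∂μ) * L) (η ⋆[B, μ] g) := by
  intro x y
  have hex : ConvolutionExists η g B μ :=
    hηc.convolutionExists_left B hη hg.continuous.locallyIntegrable
  have hηi : Integrable (fun t => ‖η t‖) μ := (hη.integrable_of_hasCompactSupport hηc).norm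
  simp only [MeasureTheory.convolution]
  rw [← integral_sub (hex x) (hex y)]
  calc ‖∫ t, (B (η t) (g (x - t)) - B (η t) (g (y - t))) ∂μ‖
      ≤ ∫ t, ‖η t‖ * (‖B‖ * L * ‖x - y‖) ∂μ := by
        refine norm_integral_le_of_norm_le (hηi.mul_const _) (Eventually.of_forall fun t => ?_)
        rw [← map_sub]
        have h1 := B.le_opNorm₂ (η t) (g (x - t) - g (y - t))
        have h2 := hg (x - t) (y - t)
        rw [sub_sub_sub_cancel_right] at h2
        calc _ ≤ _ := h1
          _ ≤ ‖B‖ * ‖η t‖ * (L * ‖x - y‖) := by gcongr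
          _ = _ := by ring
    _ = _ := by rw [integral_mul_const]; ring

set_option maxSynthPendingDepth 3 in
/-- Uniform mollification of Lipschitz functions: the bound on the second derivative depends only
on the Lipschitz constant and on the quality of the approximation. -/
theorem exists_mollification {F : Type*} [NormedAddCommGroup F] [NormedSpace ℝ F]
    [CompleteSpace F] {L ε : ℝ} (hL : 0 ≤ L) (hε : 0 < ε) :
    ∃ A : ℝ, 0 ≤ A ∧ ∀ g : X → F, LipBound L g → ∃ f : X → F, ContDiff ℝ ∞ f ∧
      (∀ x, ‖f x - g x‖ ≤ ε) ∧ LipBound L f ∧ LipBound A (fderiv ℝ f) := by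
  -- Averaging over this radius moves an `L`-Lipschitz function by at most `ε`; the `+ 1` covers `L
  -- = 0`.
  have hδ : 0 < ε / (L + 1) := by positivity
  let b : ContDiffBump (0 : X) := ⟨ε / (L + 1) / 2, ε / (L + 1), by positivity, by linarith⟩
  let η : X → ℝ := b.normed Measure.addHaar
  have hηs : ContDiff ℝ ∞ η := b.contDiff_normed
  have hηc : HasCompactSupport η := b.hasCompactSupport_normed
  let B : ℝ →L[ℝ] F →L[ℝ] F := ContinuousLinearMap.lsmul ℝ ℝ
  -- The derivative is put on the kernel, so this constant does not see `g`. The uniformity matters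
  -- because the mollified velocity changes at every Euler step.
  refine ⟨‖B.precompL (X)‖ * (∫ t, ‖fderiv ℝ η t‖ ∂Measure.addHaar) * L, by positivity, fun g hg =>
    ⟨η ⋆[B, Measure.addHaar] g, ?_, ?_, ?_, ?_⟩⟩
  · exact hηc.contDiff_convolution_left B hηs hg.continuous.locallyIntegrable
  · intro x
    rw [← dist_eq_norm]
    refine b.dist_normed_convolution_le hg.continuous.aestronglyMeasurable fun z hz => ?_
    rw [dist_eq_norm]
    refine (hg z x).trans ?_
    have : ‖z - x‖ ≤ ε / (L + 1) := by
      rw [← dist_eq_norm]; exact (Metric.mem_ball.1 hz).le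
    calc L * ‖z - x‖ ≤ (L + 1) * (ε / (L + 1)) := by gcongr; linarith
      _ = ε := by field_simp
  · refine (hg.convolution B hηs.continuous hηc).mono ?_
    have h1 : ∫ t, ‖η t‖ ∂Measure.addHaar = 1 := by
      rw [← b.integral_normed (μ := Measure.addHaar)]
      exact integral_congr_ae (Eventually.of_forall fun t =>
        by simp [η, abs_of_nonneg (b.nonneg_normed t)])
    rw [h1]
    have : ‖B‖ ≤ 1 := ContinuousLinearMap.opNorm_lsmul_le
    nlinarith
  · have : fderiv ℝ (η ⋆[B, Measure.addHaar] g) = (fderiv ℝ η ⋆[B.precompL X, Measure.addHaar] g) := funext fun x =>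
      (hηc.hasFDerivAt_convolution_left B (hηs.of_le (by simp))
        hg.continuous.locallyIntegrable x).fderiv
    rw [this]
    exact hg.convolution _ (hηs.continuous_fderiv (by simp)) (hηc.fderiv ℝ)

end Mollification

/-! ### Kantorovich duality on a compact space -/

section Duality

variable {K : Type*} [MetricSpace K] [CompactSpace K] [MeasurableSpace K]

/-- The upper bounds for the cost of a payoff `f` that can be shipped by prices `φ`, `ψ` and by
`t` units of transport, each valued at `C`. -/
def dualValues (μ ν : Measure K) (c : C(K × K, ℝ)) (C : ℝ) (f : C(K × K, ℝ)) : Set ℝ :=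
  {r | ∃ φ ψ : C(K, ℝ), ∃ t : ℝ, 0 ≤ t ∧ (∀ x y, f (x, y) ≤ φ x + ψ y + t * c (x, y)) ∧
    r = ∫ x, φ x ∂μ + ∫ y, ψ y ∂ν + t * C}

theorem dualValues_nonempty (μ ν : Measure K) (c : C(K × K, ℝ)) (C : ℝ) (f : C(K × K, ℝ)) : (dualValues μ ν c C f).Nonempty :=
  ⟨_, ContinuousMap.const K ‖f‖, 0, 0, le_rfl, fun x y => by
    simpa using (le_abs_self _).trans (f.norm_coe_le_norm (x, y)), rfl⟩

variable [BorelSpace K]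

theorem integrable_of_compactSpace {μ : Measure K} [IsFiniteMeasure μ] (φ : C(K, ℝ)) :
    Integrable φ μ :=
  φ.continuous.integrable_of_hasCompactSupport (HasCompactSupport.of_compactSpace φ)

theorem le_integral_add_integral {μ ν : Measure K} [IsProbabilityMeasure μ]
    [IsProbabilityMeasure ν] {φ ψ : C(K, ℝ)} {a : ℝ} (h : ∀ x y, a ≤ φ x + ψ y) :
    a ≤ ∫ x, φ x ∂μ + ∫ y, ψ y ∂ν := by
  have h1 : ∀ x, a - φ x ≤ ∫ y, ψ y ∂ν := fun x => by
    have := integral_mono (μ := ν) (integrable_const (a - φ x)) (integrable_of_compactSpace ψ)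
      (fun y => by linarith [h x y])
    simpa using this
  have := integral_mono (μ := μ) (integrable_const (a - ∫ y, ψ y ∂ν))
    (integrable_of_compactSpace φ) (fun x => by linarith [h1 x])
  simp only [integral_const, probReal_univ, one_smul] at this
  linarith

variable {μ ν : Measure K} [IsProbabilityMeasure μ] [IsProbabilityMeasure ν]
  {c : C(K × K, ℝ)} {C : ℝ}

/-- This is where weak duality enters: it keeps the infimum of `dualValues` finite, and nonnegative
at `f = 0`, as Hahn-Banach requires. -/
theorem lower_bound_dualValues
    (h : ∀ φ ψ : C(K, ℝ), (∀ x y, φ x + ψ y ≤ c (x, y)) → ∫ x, φ x ∂μ + ∫ y, ψ y ∂ν ≤ C)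
    {f : C(K × K, ℝ)} {a : ℝ} (ha : ∀ z, a ≤ f z) {r : ℝ} (hr : r ∈ dualValues μ ν c C f) :
    a ≤ r := by
  obtain ⟨φ, ψ, t, ht, hle, rfl⟩ := hr
  rcases ht.eq_or_lt with rfl | ht
  · simp only [zero_mul, add_zero] at hle ⊢
    exact le_integral_add_integral fun x y => (ha _).trans (hle x y)
  -- Solving `a ≤ φ + ψ + t c` for `c` gives an admissible pair of potentials for the hypothesis
  -- `h`.
  · have := h ((-t⁻¹) • φ + ContinuousMap.const K (t⁻¹ * a)) ((-t⁻¹) • ψ) fun x y => by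
      have h1 := (ha (x, y)).trans (hle x y)
      simp only [ContinuousMap.add_apply, ContinuousMap.smul_apply, smul_eq_mul,
        ContinuousMap.const_apply]
      have h2 : t * (-t⁻¹ * φ x + t⁻¹ * a + -t⁻¹ * ψ y) ≤ t * c (x, y) := by
        have : t * (-t⁻¹ * φ x + t⁻¹ * a + -t⁻¹ * ψ y) = a - φ x - ψ y := by field_simp; ring
        rw [this]; linarith
      exact le_of_mul_le_mul_left h2 ht
    simp only [ContinuousMap.add_apply, ContinuousMap.smul_apply, smul_eq_mul,
      ContinuousMap.const_apply] at this
    rw [integral_add ((integrable_of_compactSpace φ).const_mul _) (integrable_const _),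
      integral_const, probReal_univ, one_smul, integral_const_mul, integral_const_mul] at this
    have h2 := mul_le_mul_of_nonneg_left this ht.le
    have h3 : t * (-t⁻¹ * ∫ x, φ x ∂μ + t⁻¹ * a + -t⁻¹ * ∫ y, ψ y ∂ν) =
      a - ∫ x, φ x ∂μ - ∫ y, ψ y ∂ν := by field_simp; ring
    linarith

theorem bddBelow_dualValues
    (h : ∀ φ ψ : C(K, ℝ), (∀ x y, φ x + ψ y ≤ c (x, y)) → ∫ x, φ x ∂μ + ∫ y, ψ y ∂ν ≤ C)
    (f : C(K × K, ℝ)) : BddBelow (dualValues μ ν c C f) :=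
  ⟨-‖f‖, fun _ hr => lower_bound_dualValues h (fun z =>
    neg_le_of_abs_le (f.norm_coe_le_norm z)) hr⟩

/-- Kantorovich duality on a compact space, from the Hahn-Banach and Riesz theorems. -/
theorem exists_coupling_of_dual_le (c : C(K × K, ℝ)) (C : ℝ)
    (h : ∀ φ ψ : C(K, ℝ), (∀ x y, φ x + ψ y ≤ c (x, y)) → ∫ x, φ x ∂μ + ∫ y, ψ y ∂ν ≤ C) :
    ∃ π : Measure (K × K), IsFiniteMeasure π ∧ π.map Prod.fst = μ ∧ π.map Prod.snd = ν ∧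
      ∫ z, c z ∂π ≤ C := by
  -- A linear functional below the sublinear `N` is automatically positive, has the marginals `μ`
  -- and `ν`, and gives `c` at most the value `C`: each property is one choice of `φ`, `ψ`, `t`.
  -- Riesz then turns it into a coupling.
  set N : C(K × K, ℝ) → ℝ := fun f => sInf (dualValues μ ν c C f) with hN
  have hle : ∀ f (φ ψ : C(K, ℝ)) (t : ℝ), 0 ≤ t →
      (∀ x y, f (x, y) ≤ φ x + ψ y + t * c (x, y)) →
      N f ≤ ∫ x, φ x ∂μ + ∫ y, ψ y ∂ν + t * C := fun f φ ψ t ht hf =>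
    csInf_le (bddBelow_dualValues h f) ⟨φ, ψ, t, ht, hf, rfl⟩
  have hsmul : ∀ s : ℝ, 0 < s → ∀ f, N (s • f) ≤ s * N f := by
    intro s hs f
    rw [← div_le_iff₀' hs]
    refine le_csInf (dualValues_nonempty _ _ _ _ f) ?_
    rintro r ⟨φ, ψ, t, ht, hf, rfl⟩
    rw [div_le_iff₀' hs]
    refine (hle (s • f) (s • φ) (s • ψ) (s * t) (by positivity) fun x y => ?_).trans (le_of_eq ?_)
    · simp only [ContinuousMap.smul_apply, smul_eq_mul]
      nlinarith [mul_le_mul_of_nonneg_left (hf x y) hs.le]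
    · simp only [ContinuousMap.smul_apply, smul_eq_mul, integral_const_mul]
      ring
  have hhom : ∀ s : ℝ, 0 < s → ∀ f, N (s • f) = s * N f := by
    intro s hs f
    refine le_antisymm (hsmul s hs f) ?_
    have := hsmul s⁻¹ (inv_pos.2 hs) (s • f)
    rw [inv_smul_smul₀ hs.ne', inv_mul_eq_div, le_div_iff₀' hs] at this
    exact this
  have hadd : ∀ f g, N (f + g) ≤ N f + N g := by
    intro f g
    refine le_of_forall_pos_lt_add fun ε hε => ?_
    obtain ⟨_, ⟨φ, ψ, t, ht, hf, rfl⟩, h1⟩ := exists_lt_of_csInf_lt (dualValues_nonempty _ _ _ _ f)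
      (show N f < N f + ε / 2 by linarith)
    obtain ⟨_, ⟨φ', ψ', t', ht', hg, rfl⟩, h2⟩ := exists_lt_of_csInf_lt (dualValues_nonempty _ _ _ _ g)
      (show N g < N g + ε / 2 by linarith)
    have := hle (f + g) (φ + φ') (ψ + ψ') (t + t') (by positivity) fun x y => by
      simp only [ContinuousMap.add_apply]
      linarith [hf x y, hg x y]
    simp only [ContinuousMap.add_apply] at this
    rw [integral_add (integrable_of_compactSpace _) (integrable_of_compactSpace _),
      integral_add (integrable_of_compactSpace _) (integrable_of_compactSpace _)] at this
    linarith
  have hzero : 0 ≤ N 0 := le_csInf (dualValues_nonempty _ _ _ _ 0) fun r hr =>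
    lower_bound_dualValues h (fun z => by simp) hr
  -- The functional extended is the zero functional on the zero subspace, so domination only asks
  -- for `0 ≤ N 0`.
  obtain ⟨Λ, -, hΛ⟩ := exists_extension_of_le_sublinear (⊥ : C(K × K, ℝ) →ₗ.[ℝ] ℝ) N hhom hadd
    fun x => by
      have hx : (x : C(K × K, ℝ)) = 0 := (Submodule.mem_bot ℝ).1 x.2
      rw [hx, show x = 0 from Subtype.ext hx, LinearPMap.map_zero]
      exact hzero
  have hpos : ∀ f : C(K × K, ℝ), (∀ z, 0 ≤ f z) → 0 ≤ Λ f := by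
    intro f hf
    have h1 := (hΛ (-f)).trans (hle (-f) 0 0 0 le_rfl fun x y => by simpa using hf (x, y))
    simp at h1
    exact h1
  have hsum : ∀ (f : C(K × K, ℝ)) (φ ψ : C(K, ℝ)), (∀ x y, f (x, y) = φ x + ψ y) →
      Λ f = ∫ x, φ x ∂μ + ∫ y, ψ y ∂ν := by
    intro f φ ψ hf
    have h1 := (hΛ f).trans (hle f φ ψ 0 le_rfl fun x y => by simp [hf])
    have h2 := (hΛ (-f)).trans (hle (-f) (-φ) (-ψ) 0 le_rfl fun x y => by simp [hf])
    simp only [map_neg, ContinuousMap.neg_apply, integral_neg, zero_mul, add_zero] at h1 h2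
    linarith
  let Λ' : CompactlySupportedContinuousMap (K × K) ℝ →ₚ[ℝ] ℝ := PositiveLinearMap.mk₀
    { toFun := fun f => Λ f.toContinuousMap
      map_add' := fun f g => Λ.map_add _ _
      map_smul' := fun s f => Λ.map_smul _ _ } fun f hf => hpos _ fun z => hf z
  have hint : ∀ f : C(K × K, ℝ), ∫ z, f z ∂(RealRMK.rieszMeasure Λ') = Λ f := fun f =>
    RealRMK.integral_rieszMeasure Λ' ⟨f, HasCompactSupport.of_compactSpace f⟩
  refine ⟨RealRMK.rieszMeasure Λ', inferInstance, ?_, ?_, ?_⟩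
  · refine ext_of_forall_integral_eq_of_IsFiniteMeasure fun f => ?_
    rw [integral_map measurable_fst.aemeasurable f.continuous.aestronglyMeasurable]
    exact (hint (f.toContinuousMap.comp ContinuousMap.fst)).trans
      ((hsum _ f.toContinuousMap 0 fun x y => by simp).trans (by simp))
  · refine ext_of_forall_integral_eq_of_IsFiniteMeasure fun f => ?_
    rw [integral_map measurable_snd.aemeasurable f.continuous.aestronglyMeasurable]
    exact (hint (f.toContinuousMap.comp ContinuousMap.snd)).trans
      ((hsum _ 0 f.toContinuousMap fun x y => by simp).trans (by simp))
  · rw [hint]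
    simpa using (hΛ c).trans (hle c 0 0 1 zero_le_one fun x y => by simp)

end Duality

/-! ### The Wasserstein distance and Kantorovich-Rubinstein duality -/

section Wasserstein

open scoped ContDiff

variable {d : ℕ}

instance (μ : P1 d) : IsProbabilityMeasure μ.1 := μ.2.1

theorem LipBound.integrable {F : Type*} [NormedAddCommGroup F] {L : ℝ} {f : E d → F}
    (hf : LipBound L f) (μ : P1 d) : Integrable f μ.1 := by
  refine ((integrable_const ‖f 0‖).add (μ.2.2.const_mul L)).mono'
    hf.continuous.aestronglyMeasurable (Eventually.of_forall fun x => ?_)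
  have := hf x 0
  rw [sub_zero] at this
  simp only [Pi.add_apply]
  linarith [norm_le_norm_add_norm_sub' (f x) (f 0)]

theorem prod_mem_couplings (μ ν : P1 d) : μ.1.prod ν.1 ∈ couplings μ ν :=
  ⟨by simp [Measure.map_fst_prod], by simp [Measure.map_snd_prod]⟩

theorem bddBelow_costs (μ ν : P1 d) :
    BddBelow ((fun π : Measure (E d × E d) => ∫ z, ‖z.1 - z.2‖ ∂π) '' couplings μ ν) :=
  ⟨0, by rintro _ ⟨π, -, rfl⟩; exact integral_nonneg fun z => norm_nonneg _⟩

theorem W1_le_of_coupling {μ ν : P1 d} {π : Measure (E d × E d)} (h : π ∈ couplings μ ν) :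
    W1 μ ν ≤ ∫ z, ‖z.1 - z.2‖ ∂π :=
  csInf_le (bddBelow_costs μ ν) ⟨π, h, rfl⟩

theorem le_W1 {μ ν : P1 d} {a : ℝ} (h : ∀ π ∈ couplings μ ν, a ≤ ∫ z, ‖z.1 - z.2‖ ∂π) :
    a ≤ W1 μ ν :=
  le_csInf (Set.Nonempty.image _ ⟨_, prod_mem_couplings μ ν⟩)
    (by rintro _ ⟨π, hπ, rfl⟩; exact h π hπ)

theorem W1_nonneg (μ ν : P1 d) : 0 ≤ W1 μ ν :=
  le_W1 fun _ _ => integral_nonneg fun _ => norm_nonneg _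

theorem LipBound.norm_integral_sub_le_coupling {F : Type*} [NormedAddCommGroup F]
    [NormedSpace ℝ F] {L : ℝ} {f : E d → F} (hf : LipBound L f) {μ ν : P1 d}
    {π : Measure (E d × E d)} (h : π ∈ couplings μ ν) :
    ‖∫ x, f x ∂μ.1 - ∫ x, f x ∂ν.1‖ ≤ L * ∫ z, ‖z.1 - z.2‖ ∂π := by
  have h1 : MeasurePreserving Prod.fst π μ.1 := ⟨measurable_fst, h.1⟩
  have h2 : MeasurePreserving Prod.snd π ν.1 := ⟨measurable_snd, h.2⟩
  have i1 := h1.integrable_comp_of_integrable (hf.integrable μ)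
  have i2 := h2.integrable_comp_of_integrable (hf.integrable ν)
  have hid : LipBound 1 (id : E d → E d) := fun x y => by simp
  have j1 := h1.integrable_comp_of_integrable (hid.integrable μ)
  have j2 := h2.integrable_comp_of_integrable (hid.integrable ν)
  rw [← h.1, ← h.2, integral_map measurable_fst.aemeasurable hf.continuous.aestronglyMeasurable,
    integral_map measurable_snd.aemeasurable hf.continuous.aestronglyMeasurable,
    ← integral_const_mul]
  have := integral_sub i1 i2
  simp only [Function.comp_apply] at this
  rw [← this]
  exact norm_integral_le_of_norm_le ((j1.sub j2).norm.const_mul L)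
    (Eventually.of_forall fun z => hf z.1 z.2)

/-- The easy half of Kantorovich-Rubinstein duality. -/
theorem LipBound.norm_integral_sub_le {F : Type*} [NormedAddCommGroup F]
    [NormedSpace ℝ F] {L : ℝ} {f : E d → F} (hL : 0 ≤ L) (hf : LipBound L f) (μ ν : P1 d) :
    ‖∫ x, f x ∂μ.1 - ∫ x, f x ∂ν.1‖ ≤ L * W1 μ ν := by
  rcases hL.eq_or_lt with rfl | hL
  · simpa using hf.norm_integral_sub_le_coupling (prod_mem_couplings μ ν)
  · rw [← div_le_iff₀' hL]
    exact le_W1 fun π hπ => (div_le_iff₀' hL).2 (hf.norm_integral_sub_le_coupling hπ)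

theorem W1_le_of_ae_norm_le {μ ν : P1 d} {ρ : ℝ} (hμ : ∀ᵐ x ∂μ.1, ‖x‖ ≤ ρ)
    (hν : ∀ᵐ x ∂ν.1, ‖x‖ ≤ ρ) : W1 μ ν ≤ 2 * ρ := by
  refine (W1_le_of_coupling (prod_mem_couplings μ ν)).trans ?_
  have h1 := (Measure.quasiMeasurePreserving_fst (μ := μ.1) (ν := ν.1)).ae hμ
  have h2 := (Measure.quasiMeasurePreserving_snd (μ := μ.1) (ν := ν.1)).ae hν
  have := norm_integral_le_of_norm_le_const (μ := μ.1.prod ν.1)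
    (f := fun z : E d × E d => ‖z.1 - z.2‖) (C := 2 * ρ) (by
      filter_upwards [h1, h2] with z hz1 hz2
      rw [norm_norm]
      linarith [norm_sub_le z.1 z.2])
  rw [probReal_univ, mul_one] at this
  exact (le_abs_self _).trans this

/-- Kantorovich-Rubinstein duality for compactly supported measures. -/
theorem W1_le_of_forall_lipBound {μ ν : P1 d} {ρ c : ℝ} (hμ : ∀ᵐ x ∂μ.1, ‖x‖ ≤ ρ)
    (hν : ∀ᵐ x ∂ν.1, ‖x‖ ≤ ρ)
    (h : ∀ f : E d → ℝ, LipBound 1 f → ∫ x, f x ∂μ.1 - ∫ x, f x ∂ν.1 ≤ c) : W1 μ ν ≤ c := by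
  set K : Set (E d) := Metric.closedBall 0 ρ with hK
  have hKm : MeasurableSet K := Metric.isClosed_closedBall.measurableSet
  have : CompactSpace K := isCompact_iff_compactSpace.1 (isCompact_closedBall 0 ρ)
  have hemb : MeasurableEmbedding (Subtype.val : K → E d) := MeasurableEmbedding.subtype_coe hKm
  have key : ∀ μ : P1 d, (∀ᵐ x ∂μ.1, ‖x‖ ≤ ρ) →
      (μ.1.comap (Subtype.val : K → E d)).map Subtype.val = μ.1 := fun μ hμ => by
    rw [map_comap_subtype_coe hKm, Measure.restrict_eq_self_of_ae_mem]
    filter_upwards [hμ] with x hx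
    simpa [hK] using hx
  have hmap1 := key μ hμ
  have hmap2 := key ν hν
  set μ' := μ.1.comap (Subtype.val : K → E d)
  set ν' := ν.1.comap (Subtype.val : K → E d)
  have prob : ∀ (μ : P1 d) (μ' : Measure K), μ'.map Subtype.val = μ.1 →
      IsProbabilityMeasure μ' := fun μ μ' h => ⟨by
    have := congrArg (fun m : Measure (E d) => m Set.univ) h
    simpa [Measure.map_apply hemb.measurable MeasurableSet.univ] using this⟩
  have := prob μ μ' hmap1
  have := prob ν ν' hmap2
  let cost : C(K × K, ℝ) := ⟨fun z => ‖(z.1 : E d) - z.2‖, by fun_prop⟩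
  obtain ⟨π, hπ, hπ1, hπ2, hπc⟩ := exists_coupling_of_dual_le (μ := μ') (ν := ν') cost c (by
    intro φ ψ hle
    obtain ⟨x₀⟩ : Nonempty K := ⟨(nonempty_of_isProbabilityMeasure μ').some⟩
    have hbdd : ∀ x : E d, BddBelow (Set.range fun y : K => ‖x - y‖ - ψ y) := fun x =>
      ⟨-‖ψ‖, by
        rintro _ ⟨y, rfl⟩
        have := (le_abs_self _).trans (ψ.norm_coe_le_norm y)
        have := norm_nonneg (x - y)
        simp only
        linarith⟩
    have : Nonempty K := ⟨x₀⟩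
    -- The `c`-transform of `ψ` is 1-Lipschitz on the whole space, lies above `φ` and below `-ψ` on
    -- `K`, and thus replaces the pair of potentials by a single test function.
    let f : E d → ℝ := fun x => ⨅ y : K, (‖x - y‖ - ψ y)
    have hf' : ∀ x y, f x - f y ≤ ‖x - y‖ := fun x y => by
      rw [sub_le_comm]
      refine le_ciInf fun z => ?_
      have h1 : f x ≤ ‖x - z‖ - ψ z := ciInf_le (hbdd x) z
      linarith [norm_sub_le_norm_sub_add_norm_sub x y (z : E d)]
    have hf : LipBound 1 f := fun x y => by
      rw [one_mul, Real.norm_eq_abs, abs_le]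
      have := hf' y x
      rw [norm_sub_rev] at this
      exact ⟨by linarith, hf' x y⟩
    have hfc : Continuous fun x : K => f x := hf.continuous.comp continuous_subtype_val
    have h1 : ∫ x, φ x ∂μ' ≤ ∫ x, f x ∂μ.1 := by
      rw [← hmap1, hemb.integral_map]
      refine integral_mono (integrable_of_compactSpace φ)
        (integrable_of_compactSpace ⟨_, hfc⟩) fun x => ?_
      exact le_ciInf fun y => by have : φ x + ψ y ≤ ‖(x : E d) - y‖ := hle x y; linarith
    have h2 : ∫ x, f x ∂ν.1 ≤ - ∫ x, ψ x ∂ν' := by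
      rw [← hmap2, hemb.integral_map, ← integral_neg]
      refine integral_mono (integrable_of_compactSpace ⟨_, hfc⟩)
        (integrable_of_compactSpace (-ψ)) fun x => ?_
      have : f x ≤ ‖(x : E d) - x‖ - ψ x := ciInf_le (hbdd x) x
      simpa using this
    linarith [h f hf])
  have hval : Measurable (Subtype.val : K → E d) := measurable_subtype_coe
  have hpm : Measurable (Prod.map (Subtype.val : K → E d) (Subtype.val : K → E d)) :=
    hval.prodMap hval
  refine (W1_le_of_coupling (π := π.map (Prod.map Subtype.val Subtype.val)) ⟨?_, ?_⟩).trans ?_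
  · rw [Measure.map_map measurable_fst hpm, ← hmap1, ← hπ1, Measure.map_map hval measurable_fst]
    rfl
  · rw [Measure.map_map measurable_snd hpm, ← hmap2, ← hπ2, Measure.map_map hval measurable_snd]
    rfl
  · rw [integral_map hpm.aemeasurable (by fun_prop)]
    exact hπc

/-- Smooth functions that are `a`-Lipschitz with `M`-Lipschitz derivative. -/
structure TestFn (a M : ℝ) (φ : E d → ℝ) : Prop where
  smooth : ContDiff ℝ ∞ φ
  lip : LipBound a φ
  lip_fderiv : LipBound M (fderiv ℝ φ)

/-- Kantorovich-Rubinstein duality with smooth test functions. -/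
theorem W1_le_of_forall_testFn {μ ν : P1 d} {ρ c : ℝ} (hμ : ∀ᵐ x ∂μ.1, ‖x‖ ≤ ρ)
    (hν : ∀ᵐ x ∂ν.1, ‖x‖ ≤ ρ)
    (h : ∀ (φ : E d → ℝ) (M : ℝ), 0 ≤ M → TestFn 1 M φ →
      ∫ x, φ x ∂μ.1 - ∫ x, φ x ∂ν.1 ≤ c) : W1 μ ν ≤ c := by
  refine W1_le_of_forall_lipBound hμ hν fun f hf => le_of_forall_pos_le_add fun ε hε => ?_
  obtain ⟨M, hM, hmol⟩ := exists_mollification (X := E d) (F := ℝ) zero_le_one (half_pos hε)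
  obtain ⟨φ, h1, h2, h3, h4⟩ := hmol f hf
  have key : ∀ μ : P1 d, |∫ x, φ x ∂μ.1 - ∫ x, f x ∂μ.1| ≤ ε / 2 := fun μ => by
    rw [← integral_sub (h3.integrable μ) (hf.integrable μ)]
    simpa using norm_integral_le_of_norm_le_const (μ := μ.1) (Eventually.of_forall h2)
  have := h φ M hM ⟨h1, h3, h4⟩
  have k1 := abs_le.1 (key μ)
  have k2 := abs_le.1 (key ν)
  linarith

end Wasserstein

/-! ### Truncation of the interaction fields -/

section Truncation

variable {d : ℕ}

/-- The nearest point projection onto the cube `[-r, r]^d`. -/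
def clamp (r : ℝ) (x : E d) : E d := WithLp.toLp 2 fun i => max (-r) (min r (x i))

theorem clamp_apply (r : ℝ) (x : E d) (i : Fin d) : clamp r x i = max (-r) (min r (x i)) := rfl

theorem lipBound_clamp (r : ℝ) : LipBound 1 (clamp r : E d → E d) := fun x y => by
  rw [one_mul, EuclideanSpace.norm_eq, EuclideanSpace.norm_eq]
  refine Real.sqrt_le_sqrt (Finset.sum_le_sum fun i _ => ?_)
  refine pow_le_pow_left₀ (norm_nonneg _) ?_ 2
  simp only [PiLp.sub_apply, clamp_apply, Real.norm_eq_abs]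
  refine (abs_max_sub_max_le_max _ _ _ _).trans ?_
  refine max_le (by simp) ((abs_min_sub_min_le_max _ _ _ _).trans (max_le (by simp) le_rfl))

theorem clamp_eq_self {r : ℝ} {x : E d} (hx : ‖x‖ ≤ r) : clamp r x = x := by
  ext i
  have h := abs_le.1 ((PiLp.norm_apply_le x i).trans hx)
  rw [clamp_apply, min_eq_right h.2, max_eq_right h.1]

theorem norm_clamp_le_norm {r : ℝ} (hr : 0 ≤ r) (x : E d) : ‖clamp r x‖ ≤ ‖x‖ := by
  simpa [clamp_eq_self (x := (0 : E d)) (r := r) (by simpa using hr)] using lipBound_clamp r x 0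

theorem norm_clamp_le {r : ℝ} (hr : 0 ≤ r) (x : E d) : ‖clamp r x‖ ≤ √(d * r ^ 2) := by
  rw [EuclideanSpace.norm_eq]
  refine Real.sqrt_le_sqrt ?_
  calc ∑ i, ‖clamp r x i‖ ^ 2 ≤ ∑ _i : Fin d, r ^ 2 := by
        refine Finset.sum_le_sum fun i _ => pow_le_pow_left₀ (norm_nonneg _) ?_ 2
        rw [clamp_apply, Real.norm_eq_abs, abs_le]
        exact ⟨le_max_left _ _, max_le (by linarith) (min_le_left _ _)⟩
    _ = d * r ^ 2 := by simp

/-- The range of `clamp r` lies in a compact ball, where a locally Lipschitz field is bounded and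
uniformly Lipschitz. -/
theorem exists_bound_comp_clamp {F : E d → E d} (hF : LocallyLipschitz F) {r : ℝ} (hr : 0 ≤ r) :
    ∃ B L : ℝ, 0 ≤ B ∧ 0 ≤ L ∧ (∀ x, ‖F (clamp r x)‖ ≤ B) ∧ LipBound L (F ∘ clamp r) := by
  have hK : IsCompact (Metric.closedBall (0 : E d) √(d * r ^ 2)) := isCompact_closedBall _ _
  have hmem : ∀ x : E d, clamp r x ∈ Metric.closedBall (0 : E d) √(d * r ^ 2) := fun x => by
    simpa using norm_clamp_le hr x
  obtain ⟨L, hL⟩ := hF.locallyLipschitzOn.exists_lipschitzOnWith_of_compact hK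
  obtain ⟨B, hB⟩ := hK.exists_bound_of_continuousOn hF.continuous.continuousOn
  refine ⟨B, L, (norm_nonneg _).trans (hB _ (hmem 0)), L.2, fun x => hB _ (hmem x),
    fun x y => ?_⟩
  have h1 := hL.dist_le_mul _ (hmem x) _ (hmem y)
  rw [dist_eq_norm, dist_eq_norm] at h1
  have h2 := lipBound_clamp r x y
  rw [one_mul] at h2
  exact h1.trans (by gcongr)

end Truncation

/-! ### Bounds on the velocity field -/

section Velocity

variable {d m : ℕ}

/-- Interaction fields that are bounded by `B` and `L`-Lipschitz. -/
structure RegularFields (B L : ℝ) (H : E d → E d) (G : Fin d → E d → E d) : Prop where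
  B_nonneg : 0 ≤ B
  L_nonneg : 0 ≤ L
  H_le : ∀ x, ‖H x‖ ≤ B
  H_lip : LipBound L H
  G_le : ∀ ℓ x, ‖G ℓ x‖ ≤ B
  G_lip : ∀ ℓ, LipBound L (G ℓ)

theorem exists_regularFields {H : E d → E d} {G : Fin d → E d → E d} (hH : LocallyLipschitz H)
    (hG : ∀ ℓ, LocallyLipschitz (G ℓ)) {r : ℝ} (hr : 0 ≤ r) :
    ∃ B L : ℝ, RegularFields B L (H ∘ clamp r) (fun ℓ => G ℓ ∘ clamp r) := by
  obtain ⟨B, L, hB, hL, h1, h2⟩ := exists_bound_comp_clamp hH hr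
  choose B' L' hB' hL' h1' h2' using fun ℓ => exists_bound_comp_clamp (hG ℓ) hr
  have hBs : ∀ ℓ, B' ℓ ≤ ∑ ℓ, B' ℓ := fun ℓ =>
    Finset.single_le_sum (fun i _ => hB' i) (Finset.mem_univ ℓ)
  have hLs : ∀ ℓ, L' ℓ ≤ ∑ ℓ, L' ℓ := fun ℓ =>
    Finset.single_le_sum (fun i _ => hL' i) (Finset.mem_univ ℓ)
  have hB0 : 0 ≤ ∑ ℓ, B' ℓ := Finset.sum_nonneg fun i _ => hB' i
  have hL0 : 0 ≤ ∑ ℓ, L' ℓ := Finset.sum_nonneg fun i _ => hL' i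
  exact ⟨B + ∑ ℓ, B' ℓ, L + ∑ ℓ, L' ℓ, by positivity, by positivity,
    fun x => (h1 x).trans (by linarith), h2.mono (by linarith),
    fun ℓ x => (h1' ℓ x).trans (by linarith [hBs ℓ]),
    fun ℓ => (h2' ℓ).mono (by linarith [hLs ℓ])⟩

theorem norm_leaderMean_le {U c : ℝ} {a : Fin m → ℝ} {v : Fin m → E d} (hU : 0 ≤ U)
    (ha : ∀ k, |a k| ≤ U) (hc : (1 / (m : ℝ)) * ∑ k, ‖v k‖ ≤ c) :
    ‖(1 / (m : ℝ)) • ∑ k, a k • v k‖ ≤ U * c := by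
  rw [norm_smul, Real.norm_of_nonneg (by positivity)]
  calc 1 / (m : ℝ) * ‖∑ k, a k • v k‖ ≤ 1 / (m : ℝ) * ∑ k, U * ‖v k‖ := by
        gcongr
        refine norm_sum_le_of_le _ fun k _ => ?_
        rw [norm_smul]
        exact mul_le_mul_of_nonneg_right (ha k) (norm_nonneg _)
    _ = U * (1 / (m : ℝ) * ∑ k, ‖v k‖) := by rw [← Finset.mul_sum]; ring
    _ ≤ U * c := by gcongr

theorem mean_le {c : ℝ} {b : Fin m → ℝ} (hc : 0 ≤ c) (hb : ∀ k, b k ≤ c) :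
    (1 / (m : ℝ)) * ∑ k, b k ≤ c := by
  calc 1 / (m : ℝ) * ∑ k, b k ≤ 1 / (m : ℝ) * ∑ _k : Fin m, c := by
        gcongr with k _; exact hb k
    _ = (1 / (m : ℝ) * m) * c := by simp; ring
    -- An inequality rather than `m⁻¹ * m = 1`, so that `m = 0` is included.
    _ ≤ 1 * c := by
        gcongr
        rw [one_div]
        exact inv_mul_le_one
    _ = c := one_mul c

theorem norm_sum_convLeaders_le {U c : ℝ} {f : Fin d → E d} (hf : ∀ ℓ, ‖f ℓ‖ ≤ U * c) :
    ‖∑ ℓ, f ℓ‖ ≤ d * U * c := by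
  refine (norm_sum_le_of_le _ fun ℓ _ => hf ℓ).trans (le_of_eq ?_)
  simp; ring

variable {B L U : ℝ} {H : E d → E d} {G : Fin d → E d → E d} {u : Fin m → E d}

theorem abs_coord_le (hu : ‖u‖ ≤ U) (k : Fin m) (ℓ : Fin d) : |u k ℓ| ≤ U :=
  (PiLp.norm_apply_le (u k) ℓ).trans ((norm_le_pi_norm u k).trans hu)

theorem LipBound.integrable_conv (hH : LipBound L H) (μ : P1 d) (x : E d) :
    Integrable (fun y => H (x - y)) μ.1 :=
  LipBound.integrable (L := L) (fun y z => by
    simpa [norm_sub_rev] using hH (x - y) (x - z)) μ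

theorem convLeaders_sub (F : E d → E d) (ℓ : Fin d) (Y Y' : Fin m → E d) (x x' : E d) :
    convLeaders F ℓ u Y x - convLeaders F ℓ u Y' x' =
      (1 / (m : ℝ)) • ∑ k, u k ℓ • (F (x - Y k) - F (x' - Y' k)) := by
  simp only [convLeaders, ← smul_sub, ← Finset.sum_sub_distrib]

/-- Linear growth passes from the interaction fields to the velocity. -/
theorem norm_velocity_le_of_growth {C ρ : ℝ} (hC : 0 ≤ C) (hρ : 0 ≤ ρ)
    (hH : ∀ x, ‖H x‖ ≤ C * (1 + ‖x‖))
    (hG : ∀ ℓ x, ‖G ℓ x‖ ≤ C * (1 + ‖x‖)) (hu : ‖u‖ ≤ U) {p : Chi d m} (hp : ∀ k, ‖p.1 k‖ ≤ ρ)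
    (x : E d) :
    ‖velocity H G u p x‖ ≤
      C * (1 + ‖x‖ + ∫ y, ‖y‖ ∂p.2.1) + d * U * (C * (1 + ‖x‖ + ρ)) := by
  have hU : 0 ≤ U := (norm_nonneg _).trans hu
  refine (norm_add_le _ _).trans (add_le_add ?_ (norm_sum_convLeaders_le fun ℓ => ?_))
  · calc ‖conv H p.2 x‖ ≤ ∫ y, C * (1 + ‖x‖ + ‖y‖) ∂p.2.1 := by
          refine norm_integral_le_of_norm_le
            (((integrable_const _).add p.2.2.2).const_mul C) (Eventually.of_forall fun y => ?_)
          refine (hH _).trans ?_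
          exact mul_le_mul_of_nonneg_left (by linarith [norm_sub_le x y]) hC
      _ = _ := by
          rw [integral_const_mul, integral_add (integrable_const _) p.2.2.2]
          simp
  · refine norm_leaderMean_le hU (fun k => abs_coord_le hu k ℓ)
      (mean_le (by positivity) fun k => (hG ℓ _).trans ?_)
    exact mul_le_mul_of_nonneg_left (by linarith [norm_sub_le x (p.1 k), hp k]) hC

namespace RegularFields

variable (h : RegularFields B L H G)
include h

theorem norm_velocity_le (hu : ‖u‖ ≤ U) (p : Chi d m) (x : E d) :
    ‖velocity H G u p x‖ ≤ B * (1 + d * U) := by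
  have hU : 0 ≤ U := (norm_nonneg _).trans hu
  have h1 : ‖conv H p.2 x‖ ≤ B := by
    simpa [conv] using norm_integral_le_of_norm_le_const (μ := p.2.1)
      (Eventually.of_forall fun y => h.H_le (x - y))
  have h2 : ‖∑ ℓ, convLeaders (G ℓ) ℓ u p.1 x‖ ≤ d * U * B :=
    norm_sum_convLeaders_le fun ℓ => norm_leaderMean_le hU (fun k => abs_coord_le hu k ℓ)
      (mean_le h.B_nonneg fun k => h.G_le ℓ _)
  calc _ ≤ _ := norm_add_le _ _
    _ ≤ B * (1 + d * U) := by linarith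

theorem lipBound_velocity (hu : ‖u‖ ≤ U) (p : Chi d m) :
    LipBound (L * (1 + d * U)) (velocity H G u p) := fun x y => by
  have hU : 0 ≤ U := (norm_nonneg _).trans hu
  have h1 : ‖conv H p.2 x - conv H p.2 y‖ ≤ L * ‖x - y‖ := by
    rw [conv, conv, ← integral_sub (h.H_lip.integrable_conv _ _) (h.H_lip.integrable_conv _ _)]
    simpa using norm_integral_le_of_norm_le_const (μ := p.2.1)
      (Eventually.of_forall fun z => by simpa using h.H_lip (x - z) (y - z))
  have h2 : ‖∑ ℓ, (convLeaders (G ℓ) ℓ u p.1 x - convLeaders (G ℓ) ℓ u p.1 y)‖ ≤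
      d * U * (L * ‖x - y‖) :=
    norm_sum_convLeaders_le fun ℓ => by
      rw [convLeaders_sub]
      exact norm_leaderMean_le hU (fun k => abs_coord_le hu k ℓ)
        (mean_le (mul_nonneg h.L_nonneg (norm_nonneg _)) fun k => by
          simpa using h.G_lip ℓ (x - p.1 k) (y - p.1 k))
  rw [velocity, velocity, add_sub_add_comm, ← Finset.sum_sub_distrib]
  calc _ ≤ _ := norm_add_le _ _
    _ ≤ L * (1 + d * U) * ‖x - y‖ := by linarith

/-- The nonlocal part is the integral of the `L`-Lipschitz kernel `y ↦ H (x - y)` against two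
measures, hence controlled by `W1`; the leader part uses the Lipschitz bound on each `G ℓ`. -/
theorem norm_velocity_sub_le (hu : ‖u‖ ≤ U) (p q : Chi d m) (x : E d) :
    ‖velocity H G u p x - velocity H G u q x‖ ≤ L * (1 + d * U) * chiDist p q := by
  have hU : 0 ≤ U := (norm_nonneg _).trans hu
  have h1 : ‖conv H p.2 x - conv H q.2 x‖ ≤ L * W1 p.2 q.2 :=
    LipBound.norm_integral_sub_le h.L_nonneg (fun y z => by
      simpa [norm_sub_rev] using h.H_lip (x - y) (x - z)) _ _
  set D := (1 / (m : ℝ)) * ∑ k, ‖p.1 k - q.1 k‖ with hD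
  have hD0 : 0 ≤ D := by positivity
  have hW := W1_nonneg p.2 q.2
  have hL := h.L_nonneg
  have h2 : ‖∑ ℓ, (convLeaders (G ℓ) ℓ u p.1 x - convLeaders (G ℓ) ℓ u q.1 x)‖ ≤
      d * U * (L * D) :=
    norm_sum_convLeaders_le fun ℓ => by
      rw [convLeaders_sub]
      refine norm_leaderMean_le hU (fun k => abs_coord_le hu k ℓ) ?_
      rw [hD, mul_left_comm, Finset.mul_sum (f := fun k => ‖p.1 k - q.1 k‖)]
      refine mul_le_mul_of_nonneg_left (Finset.sum_le_sum fun k _ => ?_) (by positivity)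
      simpa [norm_sub_rev] using h.G_lip ℓ (x - p.1 k) (x - q.1 k)
  rw [velocity, velocity, add_sub_add_comm, ← Finset.sum_sub_distrib]
  calc _ ≤ _ := norm_add_le _ _
    _ ≤ L * W1 p.2 q.2 + d * U * (L * D) := add_le_add h1 h2
    -- The cross terms are added so that both distances carry the same factor.
    _ ≤ L * W1 p.2 q.2 + d * U * (L * D) + (L * D + d * U * (L * W1 p.2 q.2)) := by
        have : 0 ≤ L * D + d * U * (L * W1 p.2 q.2) := by positivity
        linarith
    _ = L * (1 + d * U) * (D + W1 p.2 q.2) := by ring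

end RegularFields

end Velocity

/-! ### Test functions and their rate of change along the velocity -/

section Transport

open scoped ContDiff

variable {d m : ℕ}

theorem TestFn.norm_fderiv_le {a M : ℝ} {φ : E d → ℝ} (hφ : TestFn a M φ) (ha : 0 ≤ a) (x : E d) :
    ‖fderiv ℝ φ x‖ ≤ a :=
  hφ.lip.norm_fderiv_le ha x

theorem exists_testFn_of_hasCompactSupport {φ : E d → ℝ} (hφ : ContDiff ℝ ∞ φ)
    (hc : HasCompactSupport φ) : ∃ a M : ℝ, 0 ≤ a ∧ 0 ≤ M ∧ TestFn a M φ := by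
  have h1 : ContDiff ℝ ∞ (fderiv ℝ φ) := hφ.fderiv_right (by simp)
  obtain ⟨a, ha⟩ := h1.continuous.bounded_above_of_compact_support (hc.fderiv ℝ)
  obtain ⟨M, hM⟩ := (h1.continuous_fderiv (by simp)).bounded_above_of_compact_support
    ((hc.fderiv ℝ).fderiv ℝ)
  exact ⟨a, M, (norm_nonneg _).trans (ha 0), (norm_nonneg _).trans (hM 0), hφ,
    .of_norm_fderiv_le (hφ.differentiable (by simp)) ha,
    .of_norm_fderiv_le (h1.differentiable (by simp)) hM⟩

/-- A smooth function agrees on a given ball, together with its derivative, with a smooth function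
of compact support. -/
theorem exists_hasCompactSupport_eq_on_ball {φ : E d → ℝ} (hφ : ContDiff ℝ ∞ φ) {ρ : ℝ}
    (hρ : 0 ≤ ρ) : ∃ ψ : E d → ℝ, ContDiff ℝ ∞ ψ ∧ HasCompactSupport ψ ∧
      ∀ x, ‖x‖ ≤ ρ → ψ x = φ x ∧ fderiv ℝ ψ x = fderiv ℝ φ x := by
  let b : ContDiffBump (0 : E d) := ⟨ρ + 1, ρ + 2, by positivity, by linarith⟩
  refine ⟨fun x => b x * φ x, b.contDiff.mul hφ, b.hasCompactSupport.mul_right, fun x hx => ?_⟩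
  have : (fun x => b x * φ x) =ᶠ[𝓝 x] φ := by
    filter_upwards [b.eventuallyEq_one_of_mem_ball (x := x)
      (by simpa using (show ‖x‖ < ρ + 1 by linarith))] with y hy
    rw [hy, Pi.one_apply, one_mul]
  exact ⟨this.eq_of_nhds, this.fderiv_eq⟩

/-- The rate of change `∫ ∇φ · v dν` of `∫ φ dν` along the velocity field of a state `p`. -/
def transport (φ : E d → ℝ) (H : E d → E d) (G : Fin d → E d → E d) (u : Fin m → E d)
    (p : Chi d m) (ν : P1 d) : ℝ :=
  ∫ x, fderiv ℝ φ x (velocity H G u p x) ∂ν.1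

theorem inner_gradient (φ : E d → ℝ) (x v : E d) :
    inner ℝ (gradient φ x) v = fderiv ℝ φ x v := by
  simp [gradient]

/-- The `(k, ℓ)`-th vector of the standard basis of the control space. -/
def unitControl (k : Fin m) (ℓ : Fin d) : Fin m → E d :=
  Pi.single k (EuclideanSpace.single ℓ 1)

variable {a M B L U : ℝ} {φ : E d → ℝ} {H : E d → E d} {G : Fin d → E d → E d} {u : Fin m → E d}

theorem TestFn.continuous_fderiv_apply (hφ : TestFn a M φ) {v : E d → E d}
    (hv : Continuous v) : Continuous fun x => fderiv ℝ φ x (v x) :=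
  hφ.lip_fderiv.continuous.clm_apply hv

theorem TestFn.integrable_fderiv_apply (hφ : TestFn a M φ) (ha : 0 ≤ a) {v : E d → E d} {V : ℝ}
    (hv : Continuous v) (hV : ∀ x, ‖v x‖ ≤ V) (ν : P1 d) :
    Integrable (fun x => fderiv ℝ φ x (v x)) ν.1 :=
  Integrable.of_bound (hφ.continuous_fderiv_apply hv).aestronglyMeasurable (a * V)
    (Eventually.of_forall fun x => (ContinuousLinearMap.le_opNorm _ _).trans
      (mul_le_mul (hφ.norm_fderiv_le ha x) (hV x) (norm_nonneg _) ha))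

theorem TestFn.lipBound_fderiv_apply (hφ : TestFn a M φ) (ha : 0 ≤ a) {v : E d → E d} {V Λ : ℝ}
    (hM : 0 ≤ M) (hv : LipBound Λ v) (hV : ∀ x, ‖v x‖ ≤ V) :
    LipBound (a * Λ + M * V) fun x => fderiv ℝ φ x (v x) := fun x y => by
  have h1 : fderiv ℝ φ x (v x) - fderiv ℝ φ y (v y) =
      fderiv ℝ φ x (v x - v y) + (fderiv ℝ φ x - fderiv ℝ φ y) (v y) := by
    simp
  have h2 : ‖fderiv ℝ φ x (v x - v y)‖ ≤ a * (Λ * ‖x - y‖) :=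
    (ContinuousLinearMap.le_opNorm _ _).trans
      (mul_le_mul (hφ.norm_fderiv_le ha x) (hv x y) (norm_nonneg _) ha)
  have h3 : ‖(fderiv ℝ φ x - fderiv ℝ φ y) (v y)‖ ≤ M * ‖x - y‖ * V :=
    (ContinuousLinearMap.le_opNorm _ _).trans
      (mul_le_mul (hφ.lip_fderiv x y) (hV y) (norm_nonneg _) (by positivity))
  rw [h1]
  exact (norm_add_le _ _).trans (by linarith)

namespace RegularFields

variable (h : RegularFields B L H G)
include h

/-- The velocity is affine in the control, so finitely many control-independent coefficients
determine the rate of change. This yields measurability in time and allows the control to be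
averaged exactly. -/
theorem transport_eq_sum (hφ : TestFn a M φ) (ha : 0 ≤ a) (u : Fin m → E d) (p : Chi d m)
    (ν : P1 d) :
    transport φ H G u p ν = transport φ H G 0 p ν +
      ∑ ℓ, ∑ k, u k ℓ * (transport φ H G (unitControl k ℓ) p ν - transport φ H G 0 p ν) := by
  set b : Fin d → Fin m → ℝ := fun ℓ k => (1 / (m : ℝ)) * ∫ x, fderiv ℝ φ x (G ℓ (x - p.1 k)) ∂ν.1
  have hv : ∀ u : Fin m → E d, Continuous (velocity H G u p) := fun u =>
    (h.lipBound_velocity le_rfl p).continuous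
  have hconv : conv H p.2 = velocity H G 0 p := by
    ext x; simp [velocity, convLeaders]
  have hi : Integrable (fun x => fderiv ℝ φ x (conv H p.2 x)) ν.1 := by
    rw [hconv]
    exact hφ.integrable_fderiv_apply ha (hv 0) (h.norm_velocity_le le_rfl p) ν
  have hG : ∀ ℓ k, Integrable (fun x => fderiv ℝ φ x (G ℓ (x - p.1 k))) ν.1 := fun ℓ k =>
    hφ.integrable_fderiv_apply ha
      ((h.G_lip ℓ).continuous.comp (continuous_id.sub continuous_const)) (fun x => h.G_le ℓ _) ν
  have key : ∀ u : Fin m → E d, transport φ H G u p ν =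
      ∫ x, fderiv ℝ φ x (conv H p.2 x) ∂ν.1 + ∑ ℓ, ∑ k, u k ℓ * b ℓ k := fun u => by
    simp only [transport, velocity, convLeaders, map_add, map_sum, map_smul, smul_eq_mul,
      Finset.mul_sum]
    rw [integral_add hi (integrable_finsetSum _ fun ℓ _ => integrable_finsetSum _ fun k _ =>
      ((hG ℓ k).const_mul _).const_mul _), integral_finsetSum _ fun ℓ _ =>
      integrable_finsetSum _ fun k _ => ((hG ℓ k).const_mul _).const_mul _]
    congr 1
    refine Finset.sum_congr rfl fun ℓ _ => ?_
    rw [integral_finsetSum _ fun k _ => ((hG ℓ k).const_mul _).const_mul _]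
    refine Finset.sum_congr rfl fun k _ => ?_
    rw [integral_const_mul, integral_const_mul]
    ring
  have hb : ∀ ℓ k, transport φ H G (unitControl k ℓ) p ν - transport φ H G 0 p ν = b ℓ k := by
    intro ℓ k
    rw [key, key 0]
    have : ∀ ℓ' k', unitControl k ℓ k' ℓ' * b ℓ' k' =
        if ℓ' = ℓ then (if k' = k then b ℓ' k' else 0) else 0 := fun ℓ' k' => by
      by_cases h1 : k' = k
      · subst h1
        by_cases h2 : ℓ' = ℓ <;> simp [unitControl, h2]
      · simp [unitControl, h1]
    simp [this]
  simp only [hb]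
  rw [key u, key 0]
  simp

theorem abs_transport_le (hφ : TestFn a M φ) (ha : 0 ≤ a) (hu : ‖u‖ ≤ U) (p : Chi d m)
    (ν : P1 d) : |transport φ H G u p ν| ≤ a * (B * (1 + d * U)) := by
  simpa [transport] using norm_integral_le_of_norm_le_const (μ := ν.1)
    (f := fun x => fderiv ℝ φ x (velocity H G u p x))
    (Eventually.of_forall fun x => (ContinuousLinearMap.le_opNorm _ _).trans
      (mul_le_mul (hφ.norm_fderiv_le ha x) (h.norm_velocity_le hu p x) (norm_nonneg _) ha))

theorem abs_transport_sub_state_le (hφ : TestFn a M φ) (ha : 0 ≤ a) (hu : ‖u‖ ≤ U)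
    (p q : Chi d m) (ν : P1 d) :
    |transport φ H G u p ν - transport φ H G u q ν| ≤ a * (L * (1 + d * U) * chiDist p q) := by
  have hi : ∀ p : Chi d m, Integrable (fun x => fderiv ℝ φ x (velocity H G u p x)) ν.1 := fun p =>
    hφ.integrable_fderiv_apply ha (h.lipBound_velocity hu p).continuous
      (h.norm_velocity_le hu p) ν
  rw [transport, transport, ← integral_sub (hi p) (hi q)]
  simp only [← map_sub]
  simpa using norm_integral_le_of_norm_le_const (μ := ν.1)
    (Eventually.of_forall fun x => (ContinuousLinearMap.le_opNorm (fderiv ℝ φ x) _).trans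
      (mul_le_mul (hφ.norm_fderiv_le ha x) (h.norm_velocity_sub_le hu p q x) (norm_nonneg _) ha))

/-- The integrand `x ↦ Dφ(x) v(x)` is itself Lipschitz, which is why test functions carry a bound on
the second derivative. -/
theorem abs_transport_sub_measure_le (hφ : TestFn a M φ) (ha : 0 ≤ a) (hM : 0 ≤ M)
    (hu : ‖u‖ ≤ U) (p : Chi d m) (ν ν' : P1 d) :
    |transport φ H G u p ν - transport φ H G u p ν'| ≤
      (a * (L * (1 + d * U)) + M * (B * (1 + d * U))) * W1 ν ν' := by
  have hU : 0 ≤ U := (norm_nonneg _).trans hu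
  have hB := h.B_nonneg
  have hL := h.L_nonneg
  exact LipBound.norm_integral_sub_le (by positivity)
    (hφ.lipBound_fderiv_apply ha hM (h.lipBound_velocity hu p) (h.norm_velocity_le hu p)) ν ν'

end RegularFields

end Transport

/-! ### Confined solutions: weak form and regularity in time -/

section Solutions

open scoped ContDiff

variable {d m : ℕ}

/-- A solution with measurable control bounded by `U`, regular interaction fields, and all measures
carried by the ball of radius `ρ`. -/
structure ConfinedSolution (T ρ U B L : ℝ) (H : E d → E d) (G : Fin d → E d → E d)
    (u : ℝ → Fin m → E d) (ζ : ℝ → Chi d m) : Prop where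
  fields : RegularFields B L H G
  ρ_nonneg : 0 ≤ ρ
  U_nonneg : 0 ≤ U
  measurable : AEStronglyMeasurable u (volume.restrict (Set.Icc 0 T))
  control_le : ∀ᵐ t ∂(volume.restrict (Set.Icc 0 T)), ‖u t‖ ≤ U
  support_le : ∀ t ∈ Set.Icc 0 T, ∀ᵐ x ∂(ζ t).2.1, ‖x‖ ≤ ρ
  continuous : ∀ t ∈ Set.Icc 0 T,
    Tendsto (fun s => chiDist (ζ s) (ζ t)) (𝓝[Set.Icc 0 T] t) (𝓝 0)
  leaders : ∀ t ∈ Set.Icc 0 T, ∀ k, (ζ t).1 k = (ζ 0).1 k + ∫ s in (0 : ℝ)..t, u s k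
  followers : ∀ φ : E d → ℝ, ContDiff ℝ ∞ φ → HasCompactSupport φ → ∀ t ∈ Set.Icc 0 T,
    ∫ x, φ x ∂(ζ t).2.1 = ∫ x, φ x ∂(ζ 0).2.1 +
      ∫ s in (0 : ℝ)..t, transport φ H G (u s) (ζ s) (ζ s).2

theorem W1_le_chiDist (p q : Chi d m) : W1 p.2 q.2 ≤ chiDist p q := by
  have : 0 ≤ (1 / (m : ℝ)) * ∑ k, ‖p.1 k - q.1 k‖ := by positivity
  rw [chiDist]; linarith

theorem chiDist_nonneg (p q : Chi d m) : 0 ≤ chiDist p q :=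
  (W1_nonneg _ _).trans (W1_le_chiDist p q)

/-- A bound that holds almost everywhere on `[0, T]` holds almost everywhere on subintervals. -/
theorem ae_uIoc_of_ae_Icc {T s t : ℝ} {P : ℝ → Prop}
    (hP : ∀ᵐ r ∂(volume.restrict (Set.Icc 0 T)), P r) (hs : 0 ≤ s) (hst : s ≤ t) (ht : t ≤ T) :
    ∀ᵐ r, r ∈ Set.uIoc s t → P r := by
  rw [ae_restrict_iff' measurableSet_Icc] at hP
  filter_upwards [hP] with r hr hrs
  rw [Set.uIoc_of_le hst] at hrs
  exact hr ⟨hs.trans hrs.1.le, hrs.2.trans ht⟩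

theorem intervalIntegrable_of_integrableOn_Icc {F : Type*} [NormedAddCommGroup F] {T s t : ℝ}
    {f : ℝ → F} (hf : IntegrableOn f (Set.Icc 0 T)) (hs : 0 ≤ s) (hst : s ≤ t) (ht : t ≤ T) :
    IntervalIntegrable f volume s t :=
  (intervalIntegrable_iff_integrableOn_Icc_of_le hst).2
    (hf.mono_set (Set.Icc_subset_Icc hs ht))

namespace ConfinedSolution

variable {T ρ U B L : ℝ} {H : E d → E d} {G : Fin d → E d → E d} {u : ℝ → Fin m → E d}
  {ζ : ℝ → Chi d m} (h : ConfinedSolution T ρ U B L H G u ζ) {a M : ℝ} {φ : E d → ℝ}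
include h

theorem integrableOn_control : IntegrableOn u (Set.Icc 0 T) :=
  Integrable.of_bound h.measurable U h.control_le

theorem continuousOn_transport (hφ : TestFn a M φ) (ha : 0 ≤ a) (hM : 0 ≤ M)
    (v : Fin m → E d) :
    ContinuousOn (fun s => transport φ H G v (ζ s) (ζ s).2) (Set.Icc 0 T) := by
  intro t ht
  rw [ContinuousWithinAt, tendsto_iff_norm_sub_tendsto_zero]
  have hlim := (h.continuous t ht).const_mul (a * (L * (1 + d * ‖v‖)) +
    (a * (L * (1 + d * ‖v‖)) + M * (B * (1 + d * ‖v‖))))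
  rw [mul_zero] at hlim
  refine squeeze_zero (fun s => norm_nonneg _) (fun s => ?_) hlim
  have h1 := h.fields.abs_transport_sub_state_le hφ ha (le_refl ‖v‖) (ζ s) (ζ t) (ζ s).2
  have h2 := h.fields.abs_transport_sub_measure_le hφ ha hM (le_refl ‖v‖) (ζ t) (ζ s).2 (ζ t).2
  have hB := h.fields.B_nonneg
  have hL := h.fields.L_nonneg
  have h3 : (a * (L * (1 + d * ‖v‖)) + M * (B * (1 + d * ‖v‖))) * W1 (ζ s).2 (ζ t).2 ≤
      (a * (L * (1 + d * ‖v‖)) + M * (B * (1 + d * ‖v‖))) * chiDist (ζ s) (ζ t) :=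
    mul_le_mul_of_nonneg_left (W1_le_chiDist _ _) (by positivity)
  rw [Real.norm_eq_abs]
  refine (abs_sub_le _ (transport φ H G v (ζ t) (ζ s).2) _).trans ?_
  linarith

/-- The control is only measurable in time; `transport_eq_sum` writes the integrand as a finite
combination of its coordinates with coefficients continuous on `[0, T]`. -/
theorem integrableOn_transport (hφ : TestFn a M φ) (ha : 0 ≤ a) (hM : 0 ≤ M) :
    IntegrableOn (fun s => transport φ H G (u s) (ζ s) (ζ s).2) (Set.Icc 0 T) := by
  refine Integrable.of_bound (C := a * (B * (1 + d * U))) ?_ ?_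
  · simp only [h.fields.transport_eq_sum hφ ha (u _)]
    have hm : ∀ v : Fin m → E d, AEStronglyMeasurable
        (fun s => transport φ H G v (ζ s) (ζ s).2) (volume.restrict (Set.Icc 0 T)) := fun v =>
      (h.continuousOn_transport hφ ha hM v).aestronglyMeasurable measurableSet_Icc
    refine (hm 0).add (Finset.aestronglyMeasurable_fun_sum _ fun ℓ _ =>
      Finset.aestronglyMeasurable_fun_sum _ fun k _ => ?_)
    refine AEStronglyMeasurable.mul ?_ ((hm _).sub (hm 0))
    exact (show Continuous fun v : Fin m → E d => v k ℓ by fun_prop).comp_aestronglyMeasurable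
      h.measurable
  · filter_upwards [h.control_le] with s hs
    exact h.fields.abs_transport_le hφ ha hs _ _

/-- The weak formulation holds for all smooth functions, compactly supported or not. -/
theorem integral_sub_eq (hφ : ContDiff ℝ ∞ φ) :
    IntegrableOn (fun s => transport φ H G (u s) (ζ s) (ζ s).2) (Set.Icc 0 T) ∧
    ∀ s t, 0 ≤ s → s ≤ t → t ≤ T → ∫ x, φ x ∂(ζ t).2.1 - ∫ x, φ x ∂(ζ s).2.1 =
      ∫ r in s..t, transport φ H G (u r) (ζ r) (ζ r).2 := by
  -- All measures live in the ball of radius `ρ`, so a cutoff outside it changes neither side of the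
  -- weak form.
  obtain ⟨ψ, hψ, hψc, heq⟩ := exists_hasCompactSupport_eq_on_ball hφ h.ρ_nonneg
  obtain ⟨a, M, ha, hM, hψt⟩ := exists_testFn_of_hasCompactSupport hψ hψc
  have h1 : ∀ t ∈ Set.Icc 0 T, ∫ x, ψ x ∂(ζ t).2.1 = ∫ x, φ x ∂(ζ t).2.1 := fun t ht =>
    integral_congr_ae (by
      filter_upwards [h.support_le t ht] with x hx using (heq x hx).1)
  have h2 : ∀ t ∈ Set.Icc 0 T, transport ψ H G (u t) (ζ t) (ζ t).2 =
      transport φ H G (u t) (ζ t) (ζ t).2 := fun t ht =>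
    integral_congr_ae (by
      filter_upwards [h.support_le t ht] with x hx
      rw [(heq x hx).2])
  have hi := h.integrableOn_transport hψt ha hM
  have hi' : IntegrableOn (fun s => transport φ H G (u s) (ζ s) (ζ s).2) (Set.Icc 0 T) :=
    hi.congr_fun h2 measurableSet_Icc
  refine ⟨hi', fun s t hs hst ht => ?_⟩
  have hweak : ∀ t ∈ Set.Icc 0 T, ∫ x, φ x ∂(ζ t).2.1 = ∫ x, φ x ∂(ζ 0).2.1 +
      ∫ s in (0 : ℝ)..t, transport φ H G (u s) (ζ s) (ζ s).2 := fun t ht => by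
    rw [← h1 t ht, ← h1 0 ⟨le_rfl, ht.1.trans ht.2⟩, h.followers ψ hψ hψc t ht]
    congr 1
    refine intervalIntegral.integral_congr fun r hr => h2 r ?_
    rw [Set.uIcc_of_le ht.1] at hr
    exact ⟨hr.1, hr.2.trans ht.2⟩
  rw [hweak t ⟨hs.trans hst, ht⟩, hweak s ⟨hs, hst.trans ht⟩, add_sub_add_left_eq_sub,
    intervalIntegral.integral_interval_sub_left
      (intervalIntegrable_of_integrableOn_Icc hi' le_rfl (hs.trans hst) ht)
      (intervalIntegrable_of_integrableOn_Icc hi' le_rfl hs (hst.trans ht))]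

theorem leaders_sub_eq {s t : ℝ} (hs : 0 ≤ s) (hst : s ≤ t) (ht : t ≤ T) (k : Fin m) :
    (ζ t).1 k - (ζ s).1 k = ∫ r in s..t, u r k := by
  have hi : IntegrableOn (fun r => u r k) (Set.Icc 0 T) :=
    (ContinuousLinearMap.proj k : (Fin m → E d) →L[ℝ] E d).integrable_comp
      h.integrableOn_control
  rw [h.leaders t ⟨hs.trans hst, ht⟩, h.leaders s ⟨hs, hst.trans ht⟩, add_sub_add_left_eq_sub,
    intervalIntegral.integral_interval_sub_left
      (intervalIntegrable_of_integrableOn_Icc hi le_rfl (hs.trans hst) ht)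
      (intervalIntegrable_of_integrableOn_Icc hi le_rfl hs (hst.trans ht))]

theorem norm_leaders_sub_le {s t : ℝ} (hs : 0 ≤ s) (hst : s ≤ t) (ht : t ≤ T) (k : Fin m) :
    ‖(ζ t).1 k - (ζ s).1 k‖ ≤ U * (t - s) := by
  rw [h.leaders_sub_eq hs hst ht, ← abs_of_nonneg (sub_nonneg.2 hst)]
  refine intervalIntegral.norm_integral_le_of_norm_le_const_ae (f := fun r => u r k) ?_
  filter_upwards [ae_uIoc_of_ae_Icc h.control_le hs hst ht] with r hr hrs
  exact (norm_le_pi_norm (u r) k).trans (hr hrs)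

theorem abs_integral_sub_le (hφ : TestFn a M φ) (ha : 0 ≤ a) {s t : ℝ} (hs : 0 ≤ s)
    (hst : s ≤ t) (ht : t ≤ T) :
    |∫ x, φ x ∂(ζ t).2.1 - ∫ x, φ x ∂(ζ s).2.1| ≤ a * (B * (1 + d * U)) * (t - s) := by
  rw [(h.integral_sub_eq hφ.smooth).2 s t hs hst ht, ← abs_of_nonneg (sub_nonneg.2 hst)]
  refine intervalIntegral.norm_integral_le_of_norm_le_const_ae
    (f := fun r => transport φ H G (u r) (ζ r) (ζ r).2) ?_
  filter_upwards [ae_uIoc_of_ae_Icc h.control_le hs hst ht] with r hr hrs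
  exact h.fields.abs_transport_le hφ ha (hr hrs) _ _

/-- Solutions are Lipschitz in time. -/
theorem chiDist_le {s t : ℝ} (hs : 0 ≤ s) (hst : s ≤ t) (ht : t ≤ T) :
    chiDist (ζ t) (ζ s) ≤ (U + B * (1 + d * U)) * (t - s) := by
  have hU := h.U_nonneg
  have h1 : W1 (ζ t).2 (ζ s).2 ≤ B * (1 + d * U) * (t - s) :=
    W1_le_of_forall_testFn (h.support_le t ⟨hs.trans hst, ht⟩) (h.support_le s ⟨hs, hst.trans ht⟩)
      fun φ M hM hφ => by
        simpa using (le_abs_self _).trans (h.abs_integral_sub_le hφ zero_le_one hs hst ht)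
  have h2 : (1 / (m : ℝ)) * ∑ k, ‖(ζ t).1 k - (ζ s).1 k‖ ≤ U * (t - s) :=
    mean_le (mul_nonneg hU (sub_nonneg.2 hst)) fun k => h.norm_leaders_sub_le hs hst ht k
  rw [chiDist]
  linarith

end ConfinedSolution

end Solutions

/-! ### A Gronwall principle by iterated improvement -/

section Gronwall

/-- A Gronwall argument in the weighted supremum norm: a bound with constant `S` that always
improves to one with constant `D + S / 2` holds with constant `2 * D`. -/
theorem le_two_mul_of_improving {s : Set ℝ} {f w : ℝ → ℝ} {D S₀ : ℝ} (hw : ∀ t ∈ s, 1 ≤ w t)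
    (hD : 0 ≤ D) (h₀ : ∀ t ∈ s, f t ≤ S₀)
    (hstep : ∀ S, 0 ≤ S → (∀ t ∈ s, f t ≤ S * w t) → ∀ t ∈ s, f t ≤ (D + S / 2) * w t) :
    ∀ t ∈ s, f t ≤ 2 * D * w t := by
  -- The map `S ↦ D + S / 2` has the fixed point `2 D` and halves the excess over it; the a priori
  -- bound `S₀` only starts the iteration.
  have key : ∀ n : ℕ, ∀ t ∈ s, f t ≤ (2 * D + |S₀| * (1 / 2) ^ n) * w t := by
    intro n
    induction n with
    | zero =>
      intro t ht
      have h1 := (h₀ t ht).trans (le_abs_self S₀)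
      have h2 := mul_le_mul_of_nonneg_left (hw t ht) (by positivity : 0 ≤ 2 * D + |S₀|)
      rw [pow_zero, mul_one]
      linarith
    | succ n ih =>
      intro t ht
      refine (hstep _ (by positivity) ih t ht).trans (le_of_eq ?_)
      rw [pow_succ]; ring
  intro t ht
  have hlim : Tendsto (fun n : ℕ => (2 * D + |S₀| * (1 / 2 : ℝ) ^ n) * w t) atTop
      (𝓝 ((2 * D + |S₀| * 0) * w t)) :=
    ((tendsto_const_nhds.add ((tendsto_pow_atTop_nhds_zero_of_lt_one (by norm_num)
      (by norm_num)).const_mul _)).mul_const _)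
  rw [mul_zero, add_zero] at hlim
  exact ge_of_tendsto' hlim fun n => key n t ht

end Gronwall

/-! ### A priori confinement through high moments -/

section Confinement

open scoped ContDiff

variable {d m : ℕ}

theorem integrable_of_continuous_of_ae_norm_le {μ : P1 d} {ρ : ℝ} (hμ : ∀ᵐ x ∂μ.1, ‖x‖ ≤ ρ)
    {f : E d → ℝ} (hf : Continuous f) : Integrable f μ.1 := by
  obtain ⟨c, hc⟩ := (isCompact_closedBall (0 : E d) ρ).exists_bound_of_continuousOn
    hf.continuousOn
  refine Integrable.of_bound hf.aestronglyMeasurable c ?_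
  filter_upwards [hμ] with x hx
  exact hc x (by simpa using hx)

namespace ConfinedSolution

variable {T ρ U B L : ℝ} {H : E d → E d} {G : Fin d → E d → E d} {u : ℝ → Fin m → E d}
  {ζ : ℝ → Chi d m} (h : ConfinedSolution T ρ U B L H G u ζ)
include h

/-- Gronwall for the moment `∫ φ dμ(t)`. The supremum of `φ` on the confining ball serves as the a
priori bound and drops out of the estimate, so the result does not depend on `ρ`. -/
theorem integral_le_of_transport_le {φ : E d → ℝ} (hφ : ContDiff ℝ ∞ φ) (hφ0 : ∀ x, 0 ≤ φ x)
    {c : ℝ} (hc : 0 ≤ c)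
    (htr : ∀ s ∈ Set.Icc 0 T, ∀ v : Fin m → E d, ‖v‖ ≤ U →
      transport φ H G v (ζ s) (ζ s).2 ≤ c * ∫ x, φ x ∂(ζ s).2.1) :
    ∀ t ∈ Set.Icc 0 T,
      ∫ x, φ x ∂(ζ t).2.1 ≤ 2 * (∫ x, φ x ∂(ζ 0).2.1) * Real.exp (2 * c * t) := by
  obtain ⟨b, hb⟩ := (isCompact_closedBall (0 : E d) ρ).exists_bound_of_continuousOn
    hφ.continuous.continuousOn
  have hm0 : 0 ≤ ∫ x, φ x ∂(ζ 0).2.1 := integral_nonneg hφ0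
  refine le_two_mul_of_improving (w := fun t => Real.exp (2 * c * t)) (S₀ := b)
    (fun t ht => Real.one_le_exp (mul_nonneg (by positivity) ht.1)) hm0
    (fun t ht => ?_) fun S hS hle t ht => ?_
  · have := norm_integral_le_of_norm_le_const (μ := (ζ t).2.1) (f := φ) (C := b) (by
      filter_upwards [h.support_le t ht] with x hx using hb x (by simpa using hx))
    rw [probReal_univ, mul_one] at this
    exact (le_abs_self _).trans this
  · obtain ⟨hi, heq⟩ := h.integral_sub_eq hφ
    -- The weight `exp (2 c t)` makes the integral of `c S exp (2 c r)` at most half of `S exp (2 c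
    -- t)`.
    have hder : ∀ r : ℝ, HasDerivAt (fun r => S / 2 * Real.exp (2 * c * r))
        (c * (S * Real.exp (2 * c * r))) r := fun r => by
      have := (((hasDerivAt_id r).const_mul (2 * c)).exp).const_mul (S / 2)
      refine this.congr_deriv ?_
      simp; ring
    have hcont : Continuous fun r => c * (S * Real.exp (2 * c * r)) := by fun_prop
    have h1 : ∫ r in (0 : ℝ)..t, transport φ H G (u r) (ζ r) (ζ r).2 ≤
        ∫ r in (0 : ℝ)..t, c * (S * Real.exp (2 * c * r)) := by
      refine intervalIntegral.integral_mono_ae_restrict ht.1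
        (intervalIntegrable_of_integrableOn_Icc hi le_rfl ht.1 ht.2)
        (hcont.intervalIntegrable _ _) ?_
      filter_upwards [ae_restrict_of_ae_restrict_of_subset (Set.Icc_subset_Icc_right ht.2)
        h.control_le, ae_restrict_mem measurableSet_Icc] with r hr hrt
      have hrT : r ∈ Set.Icc 0 T := ⟨hrt.1, hrt.2.trans ht.2⟩
      exact (htr r hrT _ hr).trans (mul_le_mul_of_nonneg_left (hle r hrT) hc)
    rw [intervalIntegral.integral_eq_sub_of_hasDerivAt (fun r _ => hder r)
      (hcont.intervalIntegrable _ _)] at h1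
    have h2 := heq 0 t le_rfl ht.1 ht.2
    have h3 : 1 ≤ Real.exp (2 * c * t) := Real.one_le_exp (mul_nonneg (by positivity) ht.1)
    have h4 := mul_le_mul_of_nonneg_left h3 hm0
    rw [mul_zero, Real.exp_zero] at h1
    linarith

end ConfinedSolution

/-- The weights `(1 + |x|²)^(p + 1)`. -/
def weight (p : ℕ) (x : E d) : ℝ := (1 + ‖x‖ ^ 2) ^ (p + 1)

theorem contDiff_weight (p : ℕ) : ContDiff ℝ ∞ (weight p : E d → ℝ) :=
  (contDiff_const.add (contDiff_norm_sq ℝ)).pow _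

theorem fderiv_weight_apply (p : ℕ) (x v : E d) :
    fderiv ℝ (weight p) x v = (p + 1) * (1 + ‖x‖ ^ 2) ^ p * (2 * inner ℝ x v) := by
  have h1 : HasFDerivAt (fun x : E d => 1 + ‖x‖ ^ 2) (2 • innerSL ℝ x) x :=
    (hasStrictFDerivAt_norm_sq x).hasFDerivAt.const_add 1
  have h2 := h1.pow (p + 1)
  rw [show (weight p : E d → ℝ) = fun x => (1 + ‖x‖ ^ 2) ^ (p + 1) from rfl, h2.fderiv]
  simp

theorem fderiv_weight_apply_le (p : ℕ) (x v : E d) :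
    fderiv ℝ (weight p) x v ≤ (p + 1) * (1 + ‖x‖ ^ 2) ^ p * (2 * (‖x‖ * ‖v‖)) := by
  rw [fderiv_weight_apply]
  gcongr
  exact real_inner_le_norm x v

namespace ConfinedSolution

variable {T ρ U B L : ℝ} {H : E d → E d} {G : Fin d → E d → E d} {u : ℝ → Fin m → E d}
  {ζ : ℝ → Chi d m}

theorem transport_weight_le (h : ConfinedSolution T ρ U B L H G u ζ) {s : ℝ}
    (hs : s ∈ Set.Icc 0 T) {v : Fin m → E d} {p : ℕ} {f : E d → ℝ} (hf : Continuous f)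
    (hv : ‖v‖ ≤ U)
    (hle : ∀ x, (p + 1) * (1 + ‖x‖ ^ 2) ^ p * (2 * (‖x‖ * ‖velocity H G v (ζ s) x‖)) ≤ f x) :
    transport (weight p) H G v (ζ s) (ζ s).2 ≤ ∫ x, f x ∂(ζ s).2.1 := by
  have hc : Continuous fun x => fderiv ℝ (weight p) x (velocity H G v (ζ s) x) :=
    ((contDiff_weight p).continuous_fderiv (by simp)).clm_apply
      (h.fields.lipBound_velocity hv (ζ s)).continuous
  exact integral_mono (integrable_of_continuous_of_ae_norm_le (h.support_le s hs) hc)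
    (integrable_of_continuous_of_ae_norm_le (h.support_le s hs) hf)
    fun x => (fderiv_weight_apply_le p x _).trans (hle x)

/-- The variance of `|x|` is nonnegative. This absorbs the nonlocal term of the velocity into the
second moment. -/
theorem sq_integral_norm_le {μ : P1 d} {ρ : ℝ} (hμ : ∀ᵐ x ∂μ.1, ‖x‖ ≤ ρ) :
    (∫ x, ‖x‖ ∂μ.1) ^ 2 ≤ ∫ x, ‖x‖ ^ 2 ∂μ.1 := by
  set I := ∫ x, ‖x‖ ∂μ.1
  have h2 : Integrable (fun x : E d => ‖x‖ ^ 2) μ.1 :=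
    integrable_of_continuous_of_ae_norm_le hμ (by fun_prop)
  have h1 : 0 ≤ ∫ x, (‖x‖ ^ 2 - (2 * I * ‖x‖ - I ^ 2)) ∂μ.1 :=
    integral_nonneg fun x => by
      have := sq_nonneg (‖x‖ - I)
      simp only [Pi.zero_apply]
      linarith
  have h3 : Integrable (fun x : E d => 2 * I * ‖x‖ - I ^ 2) μ.1 :=
    (μ.2.2.const_mul _).sub (integrable_const _)
  rw [integral_sub h2 h3, integral_sub (μ.2.2.const_mul _) (integrable_const _), integral_const_mul] at h1
  simp only [integral_const, probReal_univ, one_smul] at h1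
  change 0 ≤ _ - (2 * I * I - I ^ 2) at h1
  linarith

/-- Solutions starting in a ball stay in a ball whose radius only depends on the growth of the
interaction fields, on the bound for the control and on the time horizon. -/
theorem exists_confinement (d : ℕ) {C U T R : ℝ} (hC : 0 ≤ C) (hU : 0 ≤ U) (hT : 0 ≤ T)
    (hR : 0 ≤ R) :
    ∃ ρ' : ℝ, 0 ≤ ρ' ∧ ∀ {m : ℕ} {ρ B L : ℝ} {H : E d → E d} {G : Fin d → E d → E d}
      {u : ℝ → Fin m → E d} {ζ : ℝ → Chi d m}, ConfinedSolution T ρ U B L H G u ζ →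
      (∀ x, ‖H x‖ ≤ C * (1 + ‖x‖)) → (∀ ℓ x, ‖G ℓ x‖ ≤ C * (1 + ‖x‖)) →
      (∀ k, ‖(ζ 0).1 k‖ ≤ R) → (∀ᵐ x ∂(ζ 0).2.1, ‖x‖ ≤ R) →
      ∀ t ∈ Set.Icc 0 T, (∀ k, ‖(ζ t).1 k‖ ≤ ρ') ∧ ∀ᵐ x ∂(ζ t).2.1, ‖x‖ ≤ ρ' := by
  -- `r` bounds the leaders, `A` the linear growth of the velocity, `J` the first moment; `(p + 1) *
  -- c` is the growth rate of the moment of `weight p`, and `b` bounds `1 + |x|²` on the support.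
  -- None involves the constants `ρ`, `B`, `L` of a particular solution.
  set r := R + U * T with hr
  set A := C * (1 + d * U) * (1 + r) with hA
  set J := 2 * (1 + R ^ 2) * Real.exp (2 * (6 * A) * T) with hJ
  set c := 2 * A * (2 + J) with hc
  set b := Real.exp (2 * c * T) * (1 + R ^ 2) with hb
  have hr0 : 0 ≤ r := by positivity
  have hA0 : 0 ≤ A := by positivity
  have hJ0 : 0 ≤ J := by positivity
  have hc0 : 0 ≤ c := by positivity
  have hb0 : 0 < b := by positivity
  refine ⟨r + b, by positivity, fun {m ρ B L H G u ζ} h hH hG hY hμ => ?_⟩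
  have hlead : ∀ t ∈ Set.Icc 0 T, ∀ k, ‖(ζ t).1 k‖ ≤ r := fun t ht k => by
    have h1 := h.norm_leaders_sub_le le_rfl ht.1 ht.2 k
    have h2 := norm_le_norm_add_norm_sub' ((ζ t).1 k) ((ζ 0).1 k)
    have h3 := mul_le_mul_of_nonneg_left ht.2 hU
    rw [sub_zero] at h1
    linarith [hY k]
  have hvel : ∀ s ∈ Set.Icc 0 T, ∀ v : Fin m → E d, ‖v‖ ≤ U → ∀ x,
      ‖velocity H G v (ζ s) x‖ ≤ A * (1 + ‖x‖ + ∫ y, ‖y‖ ∂(ζ s).2.1) := fun s hs v hv x => by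
    have hI : 0 ≤ ∫ y, ‖y‖ ∂(ζ s).2.1 := integral_nonneg fun y => norm_nonneg y
    refine (norm_velocity_le_of_growth hC hr0 hH hG hv (hlead s hs) x).trans ?_
    set I := ∫ y, ‖y‖ ∂(ζ s).2.1
    have h1 : 1 + ‖x‖ + I ≤ (1 + r) * (1 + ‖x‖ + I) := by nlinarith [norm_nonneg x]
    have h2 : 1 + ‖x‖ + r ≤ (1 + r) * (1 + ‖x‖ + I) := by nlinarith [norm_nonneg x]
    calc _ ≤ C * ((1 + r) * (1 + ‖x‖ + I)) + d * U * (C * ((1 + r) * (1 + ‖x‖ + I))) := by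
          gcongr
      _ = _ := by rw [hA]; ring
  have hinit : ∀ p : ℕ, ∫ x, weight p x ∂(ζ 0).2.1 ≤ (1 + R ^ 2) ^ (p + 1) := fun p => by
    have := norm_integral_le_of_norm_le_const (μ := (ζ 0).2.1) (f := weight p)
      (C := (1 + R ^ 2) ^ (p + 1)) (by
        filter_upwards [hμ] with x hx
        rw [weight, Real.norm_of_nonneg (by positivity)]
        gcongr)
    rw [probReal_univ, mul_one] at this
    exact (le_abs_self _).trans this
  have hw0 : ∀ (p : ℕ) (x : E d), 0 ≤ weight p x := fun p x => by unfold weight; positivity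
  have hint : ∀ s ∈ Set.Icc 0 T, ∀ f : E d → ℝ, Continuous f → Integrable f (ζ s).2.1 :=
    fun s hs f hf => integrable_of_continuous_of_ae_norm_le (h.support_le s hs) hf
  have hmom : ∀ s ∈ Set.Icc 0 T, ∫ y, ‖y‖ ∂(ζ s).2.1 ≤ J := by
    intro t ht
    have h1 := h.integral_le_of_transport_le (contDiff_weight 0) (hw0 0)
      (c := 6 * A) (by positivity) (fun s hs v hv => by
        set I := ∫ y, ‖y‖ ∂(ζ s).2.1 with hI
        have hI0 : 0 ≤ I := integral_nonneg fun y => norm_nonneg y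
        refine (h.transport_weight_le hs (f := fun x =>
          2 * A * (2 * (1 + ‖x‖ ^ 2) + ‖x‖ * I)) (by fun_prop) hv fun x => ?_).trans ?_
        · have h1 := mul_le_mul_of_nonneg_left (hvel s hs v hv x) (norm_nonneg x)
          have h2 : ‖x‖ * (1 + ‖x‖ + I) ≤ 2 * (1 + ‖x‖ ^ 2) + ‖x‖ * I := by
            nlinarith [sq_nonneg (‖x‖ - 1), norm_nonneg x]
          have h3 := mul_le_mul_of_nonneg_left h2 hA0
          simp only [Nat.cast_zero, zero_add, pow_zero, one_mul]
          linarith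
        · have hsq := sq_integral_norm_le (h.support_le s hs)
          have i1 := hint s hs (fun x => ‖x‖ ^ 2) (by fun_prop)
          have e1 : ∫ x, weight 0 x ∂(ζ s).2.1 = 1 + ∫ x, ‖x‖ ^ 2 ∂(ζ s).2.1 := by
            simp only [weight, zero_add, pow_one]
            rw [integral_add (integrable_const _) i1]
            simp
          have e2 : ∫ x, 2 * A * (2 * (1 + ‖x‖ ^ 2) + ‖x‖ * I) ∂(ζ s).2.1 =
              2 * A * (2 * (1 + ∫ x, ‖x‖ ^ 2 ∂(ζ s).2.1) + I * I) := by
            have i2 : Integrable (fun x : E d => 2 * (1 + ‖x‖ ^ 2)) (ζ s).2.1 :=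
              ((integrable_const _).add i1).const_mul _
            rw [integral_const_mul, integral_add i2 ((ζ s).2.2.2.mul_const _),
              integral_const_mul, integral_mul_const, integral_add (integrable_const _) i1]
            simp [hI]
          rw [e1, e2]
          have h4 : 2 * (1 + ∫ x, ‖x‖ ^ 2 ∂(ζ s).2.1) + I * I ≤
              3 * (1 + ∫ x, ‖x‖ ^ 2 ∂(ζ s).2.1) := by nlinarith
          nlinarith [mul_le_mul_of_nonneg_left h4 hA0]) t ht
    have h2 : ∫ y, ‖y‖ ∂(ζ t).2.1 ≤ ∫ x, weight 0 x ∂(ζ t).2.1 :=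
      integral_mono (ζ t).2.2.2 (hint t ht _ (contDiff_weight 0).continuous) fun x => by
        simp only [weight, zero_add, pow_one]
        nlinarith [sq_nonneg (‖x‖ - 1), norm_nonneg x]
    have h3 : Real.exp (2 * (6 * A) * t) ≤ Real.exp (2 * (6 * A) * T) := by
      gcongr; exact ht.2
    calc _ ≤ _ := h2.trans h1
      _ ≤ 2 * (1 + R ^ 2) ^ (0 + 1) * Real.exp (2 * (6 * A) * T) := by
        gcongr
        exact hinit 0
      _ = J := by rw [hJ]; ring
  -- With the first moment bounded by `J`, the growth rate is linear in `p + 1`, so the moment bound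
  -- is a geometric sequence; its prefactor 2 disappears as `p → ∞`.
  have hweight : ∀ p : ℕ, ∀ t ∈ Set.Icc 0 T, ∫ x, weight p x ∂(ζ t).2.1 ≤ 2 * b ^ (p + 1) := by
    intro p t ht
    have h1 := h.integral_le_of_transport_le (contDiff_weight p) (hw0 p)
      (c := (p + 1) * c) (by positivity) (fun s hs v hv => by
        rw [← integral_const_mul]
        refine h.transport_weight_le hs ((contDiff_weight p).continuous.const_mul _) hv
          fun x => ?_
        have h1 : ‖x‖ * ‖velocity H G v (ζ s) x‖ ≤ A * ((2 + J) * (1 + ‖x‖ ^ 2)) := by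
          have h2 : ‖velocity H G v (ζ s) x‖ ≤ A * (1 + ‖x‖ + J) :=
            (hvel s hs v hv x).trans (by gcongr; exact hmom s hs)
          have h3 : ‖x‖ * (1 + ‖x‖ + J) ≤ (2 + J) * (1 + ‖x‖ ^ 2) := by
            nlinarith [sq_nonneg (‖x‖ - 1), norm_nonneg x,
              mul_nonneg hJ0 (sq_nonneg (‖x‖ - 1)), mul_nonneg hJ0 (norm_nonneg x)]
          calc _ ≤ ‖x‖ * (A * (1 + ‖x‖ + J)) := by gcongr
            _ = A * (‖x‖ * (1 + ‖x‖ + J)) := by ring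
            _ ≤ _ := by gcongr
        calc _ ≤ ((p : ℝ) + 1) * (1 + ‖x‖ ^ 2) ^ p *
              (2 * (A * ((2 + J) * (1 + ‖x‖ ^ 2)))) := by gcongr
          _ = ((p : ℝ) + 1) * c * weight p x := by rw [weight, hc, pow_succ]; ring) t ht
    have h2 : Real.exp (2 * (((p : ℝ) + 1) * c) * t) ≤ Real.exp (2 * c * T) ^ (p + 1) := by
      rw [← Real.exp_nat_mul]
      refine Real.exp_le_exp.2 ?_
      push_cast
      have := mul_le_mul_of_nonneg_left ht.2 (by positivity : 0 ≤ ((p : ℝ) + 1) * (2 * c))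
      linarith
    calc _ ≤ _ := h1
      _ ≤ 2 * (1 + R ^ 2) ^ (p + 1) * Real.exp (2 * c * T) ^ (p + 1) := by
        gcongr
        exact hinit p
      _ = 2 * b ^ (p + 1) := by rw [hb, mul_pow]; ring
  intro t ht
  refine ⟨fun k => (hlead t ht k).trans (by linarith), ?_⟩
  have hae : ∀ᵐ x ∂(ζ t).2.1, 1 + ‖x‖ ^ 2 ≤ b := by
    rw [ae_le_const_iff_forall_gt_measure_zero]
    intro a hab
    have ha0 : 0 < a := hb0.trans hab
    set θ := (ζ t).2.1.real {x | a ≤ 1 + ‖x‖ ^ 2} with hθ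
    -- Markov's inequality for `weight p`; as `b < a`, letting `p → ∞` leaves no mass on the set.
    have hbound : ∀ p : ℕ, θ ≤ 2 * (b / a) ^ (p + 1) := fun p => by
      have h1 := mul_meas_ge_le_integral_of_nonneg (μ := (ζ t).2.1)
        (Eventually.of_forall (hw0 p)) (hint t ht _ (contDiff_weight p).continuous) (a ^ (p + 1))
      have h2 : {x : E d | a ^ (p + 1) ≤ weight p x} = {x | a ≤ 1 + ‖x‖ ^ 2} := by
        ext x
        exact pow_le_pow_iff_left₀ ha0.le (by positivity) (by simp)
      rw [h2] at h1
      rw [div_pow, ← mul_div_assoc, le_div_iff₀' (by positivity)]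
      exact h1.trans (hweight p t ht)
    have hlim : Tendsto (fun p : ℕ => 2 * (b / a) ^ (p + 1)) atTop (𝓝 (2 * 0)) :=
      ((tendsto_add_atTop_iff_nat 1).2 (tendsto_pow_atTop_nhds_zero_of_lt_one (by positivity)
        ((div_lt_one ha0).2 hab))).const_mul 2
    rw [mul_zero] at hlim
    have h0 : θ = 0 := le_antisymm (ge_of_tendsto' hlim hbound) measureReal_nonneg
    exact (measureReal_eq_zero_iff).1 h0
  filter_upwards [hae] with x hx
  nlinarith [sq_nonneg (‖x‖ - 1), norm_nonneg x]

end ConfinedSolution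

end Confinement

/-! ### Consistency of one explicit Euler step -/

section EulerStep

open scoped ContDiff

variable {d m : ℕ}

/-- Precomposition with an explicit Euler step preserves the class of test functions. -/
theorem TestFn.comp_euler {a M Λ A h : ℝ} {φ : E d → ℝ} (hφ : TestFn a M φ) (ha : 0 ≤ a)
    (hM : 0 ≤ M) (hΛ : 0 ≤ Λ) (hh : 0 ≤ h) {w : E d → E d} (hw : ContDiff ℝ ∞ w)
    (hwΛ : LipBound Λ w) (hwA : LipBound A (fderiv ℝ w)) :
    TestFn (a * (1 + h * Λ)) (M * (1 + h * Λ) ^ 2 + a * (h * A)) fun x => φ (x + h • w x) := by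
  have hstep : ∀ x y, ‖x + h • w x - (y + h • w y)‖ ≤ (1 + h * Λ) * ‖x - y‖ := fun x y => by
    rw [add_sub_add_comm, ← smul_sub]
    refine (norm_add_le _ _).trans ?_
    rw [norm_smul, Real.norm_of_nonneg hh]
    nlinarith [mul_le_mul_of_nonneg_left (hwΛ x y) hh]
  have hφd : Differentiable ℝ φ := hφ.smooth.differentiable (by simp)
  have hwd : Differentiable ℝ w := hw.differentiable (by simp)
  have hfd : ∀ x, fderiv ℝ (fun x => φ (x + h • w x)) x =
      (fderiv ℝ φ (x + h • w x)).comp (ContinuousLinearMap.id ℝ (E d) + h • fderiv ℝ w x) :=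
    fun x => ((hφd _).hasFDerivAt.comp x
      ((hasFDerivAt_id x).add ((hwd x).hasFDerivAt.const_smul h))).fderiv
  refine ⟨hφ.smooth.comp (contDiff_id.add (hw.const_smul h)), fun x y => ?_,
    fun x y => ?_⟩
  · refine (hφ.lip _ _).trans ?_
    rw [mul_assoc]
    exact mul_le_mul_of_nonneg_left (hstep x y) ha
  · rw [hfd, hfd]
    set D₁ := fderiv ℝ φ (x + h • w x)
    set D₂ := fderiv ℝ φ (y + h • w y)
    set E₁ := ContinuousLinearMap.id ℝ (E d) + h • fderiv ℝ w x with hE₁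
    set E₂ := ContinuousLinearMap.id ℝ (E d) + h • fderiv ℝ w y with hE₂
    have h1 : D₁.comp E₁ - D₂.comp E₂ = (D₁ - D₂).comp E₁ + D₂.comp (E₁ - E₂) := by
      ext v; simp
    have h2 : ‖E₁‖ ≤ 1 + h * Λ := by
      refine (norm_add_le _ _).trans (add_le_add ContinuousLinearMap.norm_id_le ?_)
      rw [norm_smul, Real.norm_of_nonneg hh]
      exact mul_le_mul_of_nonneg_left (hwΛ.norm_fderiv_le hΛ x) hh
    have h3 : ‖E₁ - E₂‖ ≤ h * (A * ‖x - y‖) := by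
      have : E₁ - E₂ = h • (fderiv ℝ w x - fderiv ℝ w y) := by
        ext v; simp [hE₁, hE₂, mul_sub]
      rw [this, norm_smul, Real.norm_of_nonneg hh]
      exact mul_le_mul_of_nonneg_left (hwA x y) hh
    have h4 : ‖D₁ - D₂‖ ≤ M * ((1 + h * Λ) * ‖x - y‖) :=
      (hφ.lip_fderiv _ _).trans (mul_le_mul_of_nonneg_left (hstep x y) hM)
    rw [h1]
    calc _ ≤ ‖D₁ - D₂‖ * ‖E₁‖ + ‖D₂‖ * ‖E₁ - E₂‖ :=
          (norm_add_le _ _).trans (add_le_add (ContinuousLinearMap.opNorm_comp_le _ _)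
            (ContinuousLinearMap.opNorm_comp_le _ _))
      _ ≤ M * ((1 + h * Λ) * ‖x - y‖) * (1 + h * Λ) + a * (h * (A * ‖x - y‖)) := by
          gcongr
          exact hφ.norm_fderiv_le ha _
      _ = _ := by ring

/-- Mean value inequality on the ball of radius `‖y‖` about `x`, where the derivative varies by at
most `M ‖y‖`; the sharper factor 1/2 is not needed. -/
theorem TestFn.abs_taylor_le {a M : ℝ} {φ : E d → ℝ} (hφ : TestFn a M φ) (hM : 0 ≤ M)
    (x y : E d) : |φ (x + y) - φ x - fderiv ℝ φ x y| ≤ M * ‖y‖ ^ 2 := by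
  have := (convex_closedBall x ‖y‖).norm_image_sub_le_of_norm_fderiv_le' (𝕜 := ℝ) (f := φ)
    (φ := fderiv ℝ φ x) (C := M * ‖y‖) (x := x) (y := x + y)
    (fun z _ => hφ.smooth.differentiable (by simp) z)
    (fun z hz => (hφ.lip_fderiv z x).trans (mul_le_mul_of_nonneg_left
      (by simpa [dist_eq_norm] using hz) hM)) (by simp) (by simp)
  rw [add_sub_cancel_left, Real.norm_eq_abs] at this
  linarith

namespace ConfinedSolution

variable {T ρ U B L : ℝ} {H : E d → E d} {G : Fin d → E d → E d} {u : ℝ → Fin m → E d}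
  {ζ : ℝ → Chi d m} {a M : ℝ} {φ : E d → ℝ}

/-- The mean value of the control over `[s, s + h]`. -/
def meanControl (u : ℝ → Fin m → E d) (s h : ℝ) : Fin m → E d := h⁻¹ • ∫ r in s..(s + h), u r

section

variable (hζ : ConfinedSolution T ρ U B L H G u ζ)
include hζ

theorem norm_meanControl_le {s h : ℝ} (hs : 0 ≤ s) (hh : 0 ≤ h) (hT : s + h ≤ T) :
    ‖meanControl u s h‖ ≤ U := by
  have h1 : ‖∫ r in s..(s + h), u r‖ ≤ U * |s + h - s| :=
    intervalIntegral.norm_integral_le_of_norm_le_const_ae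
      (ae_uIoc_of_ae_Icc hζ.control_le hs (by linarith) hT)
  rw [add_sub_cancel_left, abs_of_nonneg hh] at h1
  rw [meanControl, norm_smul, norm_inv, Real.norm_of_nonneg hh]
  rcases hh.eq_or_lt with rfl | hh
  · simpa using hζ.U_nonneg
  · rwa [inv_mul_le_iff₀ hh, mul_comm]

/-- With state and measure frozen, the rate of change is affine in the control, so replacing the
control by its mean over the step costs nothing, however irregular it is in time. -/
theorem integral_transport_frozen (hφ : TestFn a M φ) (ha : 0 ≤ a) {s h : ℝ} (hs : 0 ≤ s)
    (hh : 0 ≤ h) (hT : s + h ≤ T) (p : Chi d m) (ν : P1 d) :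
    IntervalIntegrable (fun r => transport φ H G (u r) p ν) volume s (s + h) ∧
    ∫ r in s..(s + h), transport φ H G (u r) p ν =
      h * transport φ H G (meanControl u s h) p ν := by
  have hi : IntervalIntegrable u volume s (s + h) :=
    intervalIntegrable_of_integrableOn_Icc hζ.integrableOn_control hs (by linarith) hT
  let ev : Fin d → Fin m → (Fin m → E d) →L[ℝ] ℝ := fun ℓ k =>
    (EuclideanSpace.proj ℓ : E d →L[ℝ] ℝ).comp
      (ContinuousLinearMap.proj k : (Fin m → E d) →L[ℝ] E d)
  let Ψ : (Fin m → E d) →L[ℝ] ℝ := ∑ ℓ, ∑ k,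
    (transport φ H G (unitControl k ℓ) p ν - transport φ H G 0 p ν) • ev ℓ k
  have heq : ∀ v, transport φ H G v p ν = transport φ H G 0 p ν + Ψ v := fun v => by
    rw [hζ.fields.transport_eq_sum hφ ha v p ν]
    simp [Ψ, ev, mul_comm]
  have hΨ : IntervalIntegrable (fun r => Ψ (u r)) volume s (s + h) :=
    ⟨Ψ.integrable_comp hi.1, Ψ.integrable_comp hi.2⟩
  have hmean : h • meanControl u s h = ∫ r in s..(s + h), u r := by
    rcases hh.eq_or_lt with rfl | hh
    · simp
    · rw [meanControl, smul_inv_smul₀ hh.ne']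
  have hint : ∫ r in s..(s + h), Ψ (u r) = h * Ψ (meanControl u s h) := by
    rw [← smul_eq_mul, ← map_smul, hmean, ContinuousLinearMap.intervalIntegral_comp_comm Ψ hi]
  simp only [heq (u _)]
  refine ⟨intervalIntegrable_const.add hΨ, ?_⟩
  rw [intervalIntegral.integral_add intervalIntegrable_const hΨ, hint,
    intervalIntegral.integral_const, heq (meanControl u s h), add_sub_cancel_left, smul_eq_mul]
  ring

/-- Consistency of one explicit Euler step, tested against a smooth function: the velocity is
frozen at a state `p`, averaged in time and perturbed by at most `ε`. -/
theorem abs_integral_sub_euler_le (hφ : TestFn a M φ) (ha : 0 ≤ a) (hM : 0 ≤ M) {s h ε : ℝ}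
    (hs : 0 ≤ s) (hh : 0 ≤ h) (hT : s + h ≤ T) (p : Chi d m) {w : E d → E d}
    (hwc : Continuous w)
    (hw : ∀ x, ‖w x - velocity H G (meanControl u s h) p x‖ ≤ ε) :
    |∫ x, φ x ∂(ζ (s + h)).2.1 - ∫ x, φ (x + h • w x) ∂(ζ s).2.1| ≤
      a * h * (L * (1 + d * U)) * chiDist (ζ s) p + a * h * ε +
      h ^ 2 * ((2 * (a * (L * (1 + d * U))) + M * (B * (1 + d * U))) * (U + B * (1 + d * U)) +
        M * (B * (1 + d * U) + ε) ^ 2) := by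
  have hU := hζ.U_nonneg
  have hB := hζ.fields.B_nonneg
  have hL := hζ.fields.L_nonneg
  have hsh : s ≤ s + h := by linarith
  have hε : 0 ≤ ε := (norm_nonneg _).trans (hw 0)
  set V := B * (1 + d * U) with hV
  set Λ := L * (1 + d * U) with hΛ
  have hV0 : 0 ≤ V := by positivity
  have hΛ0 : 0 ≤ Λ := by positivity
  set v := velocity H G (meanControl u s h) p with hv
  have hm := hζ.norm_meanControl_le hs hh hT
  have hvV : ∀ x, ‖v x‖ ≤ V := hζ.fields.norm_velocity_le hm p
  have hvc : Continuous v := (hζ.fields.lipBound_velocity hm p).continuous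
  obtain ⟨hi0, hweak⟩ := hζ.integral_sub_eq hφ.smooth
  have hi := intervalIntegrable_of_integrableOn_Icc hi0 hs hsh hT
  obtain ⟨hif, hfrozen⟩ := hζ.integral_transport_frozen hφ ha hs hh hT p (ζ s).2
  have h1 : |∫ x, φ x ∂(ζ (s + h)).2.1 - ∫ x, φ x ∂(ζ s).2.1 -
      h * transport φ H G (meanControl u s h) p (ζ s).2| ≤
      (a * (Λ * chiDist (ζ s) p) + (2 * (a * Λ) + M * V) * ((U + V) * h)) * h := by
    rw [hweak s (s + h) hs hsh hT, ← hfrozen, ← intervalIntegral.integral_sub hi hif]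
    -- Three replacements: the state at time `r` by that at `s`, then by `p`, and the measure at `r`
    -- by that at `s`. The first and third cost `O(h)` because solutions are Lipschitz in time.
    have hb : ∀ᵐ r, r ∈ Set.uIoc s (s + h) → ‖transport φ H G (u r) (ζ r) (ζ r).2 -
        transport φ H G (u r) p (ζ s).2‖ ≤
        a * (Λ * chiDist (ζ s) p) + (2 * (a * Λ) + M * V) * ((U + V) * h) := by
      filter_upwards [ae_uIoc_of_ae_Icc hζ.control_le hs hsh hT] with r hr hrs
      have hur := hr hrs
      rw [Set.uIoc_of_le hsh] at hrs
      have hdist : chiDist (ζ r) (ζ s) ≤ (U + V) * h :=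
        (hζ.chiDist_le hs hrs.1.le (hrs.2.trans hT)).trans
          (mul_le_mul_of_nonneg_left (by linarith [hrs.2]) (by positivity))
      have e1 := hζ.fields.abs_transport_sub_state_le hφ ha hur (ζ r) (ζ s) (ζ r).2
      have e2 := hζ.fields.abs_transport_sub_state_le hφ ha hur (ζ s) p (ζ r).2
      have e3 := hζ.fields.abs_transport_sub_measure_le hφ ha hM hur p (ζ r).2 (ζ s).2
      have e4 : a * (Λ * chiDist (ζ r) (ζ s)) ≤ a * (Λ * ((U + V) * h)) := by gcongr
      have e5 : (a * Λ + M * V) * W1 (ζ r).2 (ζ s).2 ≤ (a * Λ + M * V) * ((U + V) * h) :=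
        mul_le_mul_of_nonneg_left ((W1_le_chiDist _ _).trans hdist) (by positivity)
      rw [Real.norm_eq_abs]
      have t1 := abs_sub_le (transport φ H G (u r) (ζ r) (ζ r).2)
        (transport φ H G (u r) (ζ s) (ζ r).2) (transport φ H G (u r) p (ζ s).2)
      have t2 := abs_sub_le (transport φ H G (u r) (ζ s) (ζ r).2)
        (transport φ H G (u r) p (ζ r).2) (transport φ H G (u r) p (ζ s).2)
      linarith
    have := intervalIntegral.norm_integral_le_of_norm_le_const_ae hb
    rwa [add_sub_cancel_left, abs_of_nonneg hh] at this
  -- Second-order Taylor expansion of `φ` along the step, followed by replacing `w` with the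
  -- velocity at cost `a h ε`.
  have h2 : |∫ x, φ (x + h • w x) ∂(ζ s).2.1 - ∫ x, φ x ∂(ζ s).2.1 -
      h * transport φ H G (meanControl u s h) p (ζ s).2| ≤
      M * (h * (V + ε)) ^ 2 + a * (h * ε) := by
    have i1 : Integrable (fun x => φ (x + h • w x)) (ζ s).2.1 :=
      integrable_of_continuous_of_ae_norm_le (hζ.support_le s ⟨hs, hsh.trans hT⟩)
        (hφ.lip.continuous.comp (continuous_id.add (hwc.const_smul h)))
    have i2 := hφ.lip.integrable (ζ s).2
    have i3 : Integrable (fun x => h * fderiv ℝ φ x (v x)) (ζ s).2.1 :=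
      (hφ.integrable_fderiv_apply ha hvc hvV (ζ s).2).const_mul h
    rw [transport, ← integral_const_mul, ← integral_sub i1 i2]
    rw [← integral_sub (f := fun x => φ (x + h • w x) - φ x) (i1.sub i2) i3]
    have := norm_integral_le_of_norm_le_const (μ := (ζ s).2.1)
      (f := fun x => φ (x + h • w x) - φ x - h * fderiv ℝ φ x (v x))
      (C := M * (h * (V + ε)) ^ 2 + a * (h * ε)) (Eventually.of_forall fun x => by
        have t1 := hφ.abs_taylor_le hM x (h • w x)
        have hwx : ‖w x‖ ≤ V + ε := by
          linarith [norm_le_norm_add_norm_sub' (w x) (v x), hw x, hvV x]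
        have t2 : ‖h • w x‖ ≤ h * (V + ε) := by
          rw [norm_smul, Real.norm_of_nonneg hh]
          gcongr
        have t3 : M * ‖h • w x‖ ^ 2 ≤ M * (h * (V + ε)) ^ 2 := by gcongr
        have t4 : ‖fderiv ℝ φ x (w x - v x)‖ ≤ a * ε :=
          (ContinuousLinearMap.le_opNorm _ _).trans
            (mul_le_mul (hφ.norm_fderiv_le ha x) (hw x) (norm_nonneg _) ha)
        have t5 : φ (x + h • w x) - φ x - h * fderiv ℝ φ x (v x) =
            φ (x + h • w x) - φ x - fderiv ℝ φ x (h • w x) +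
              h * fderiv ℝ φ x (w x - v x) := by
          rw [map_smul, map_sub, smul_eq_mul]; ring
        rw [t5]
        refine (norm_add_le _ _).trans ?_
        rw [norm_mul, Real.norm_of_nonneg hh, Real.norm_eq_abs]
        linarith [mul_le_mul_of_nonneg_left t4 hh])
    rwa [probReal_univ, mul_one] at this
  have h3 := abs_sub_le (∫ x, φ x ∂(ζ (s + h)).2.1 - ∫ x, φ x ∂(ζ s).2.1)
    (h * transport φ H G (meanControl u s h) p (ζ s).2)
    (∫ x, φ (x + h • w x) ∂(ζ s).2.1 - ∫ x, φ x ∂(ζ s).2.1)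
  rw [sub_sub_sub_cancel_right, abs_sub_comm (h * _)] at h3
  calc _ ≤ _ := h3
    _ ≤ _ := add_le_add h1 h2
    _ = _ := by ring

end

end ConfinedSolution

end EulerStep

/-! ### Stability of confined solutions -/

section Stability

open scoped ContDiff

variable {d m : ℕ}

theorem W1_self {μ : P1 d} {ρ : ℝ} (hμ : ∀ᵐ x ∂μ.1, ‖x‖ ≤ ρ) : W1 μ μ = 0 :=
  le_antisymm (W1_le_of_forall_lipBound hμ hμ fun f _ => by simp) (W1_nonneg _ _)

namespace ConfinedSolution

variable {T ρ U B L : ℝ} {H : E d → E d} {G : Fin d → E d → E d} {u : ℝ → Fin m → E d}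
  {ζ₁ ζ₂ : ℝ → Chi d m}
  (h₁ : ConfinedSolution T ρ U B L H G u ζ₁) (h₂ : ConfinedSolution T ρ U B L H G u ζ₂)
include h₁ h₂

/-- One backward Euler step for the difference of two solutions. -/
theorem exists_euler_step {ε A : ℝ}
    (hmol : ∀ g : E d → E d, LipBound (L * (1 + d * U)) g → ∃ f : E d → E d, ContDiff ℝ ∞ f ∧
      (∀ x, ‖f x - g x‖ ≤ ε) ∧ LipBound (L * (1 + d * U)) f ∧ LipBound A (fderiv ℝ f))
    {a M : ℝ} {φ : E d → ℝ} (hφ : TestFn a M φ) (ha : 0 ≤ a) (hM : 0 ≤ M) {s h : ℝ}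
    (hs : 0 ≤ s) (hh : 0 ≤ h) (hT : s + h ≤ T) :
    ∃ Φ : E d → ℝ, TestFn (a * (1 + h * (L * (1 + d * U))))
        (M * (1 + h * (L * (1 + d * U))) ^ 2 + a * (h * A)) Φ ∧
      ∫ x, φ x ∂(ζ₁ (s + h)).2.1 - ∫ x, φ x ∂(ζ₂ (s + h)).2.1 ≤
        ∫ x, Φ x ∂(ζ₁ s).2.1 - ∫ x, Φ x ∂(ζ₂ s).2.1 +
        a * h * (L * (1 + d * U)) * chiDist (ζ₁ s) (ζ₂ s) + 2 * (a * h * ε +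
        h ^ 2 * ((2 * (a * (L * (1 + d * U))) + M * (B * (1 + d * U))) * (U + B * (1 + d * U)) +
          M * (B * (1 + d * U) + ε) ^ 2)) := by
  have hΛ : 0 ≤ L * (1 + d * U) := by
    have := h₁.U_nonneg
    have := h₁.fields.L_nonneg
    positivity
  -- One field, frozen at the second solution, serves both: consistency for `ζ₂` has no freezing
  -- error, while that for `ζ₁` is the coupling term to be estimated by Gronwall.
  obtain ⟨w, hw, hwε, hwΛ, hwA⟩ := hmol _
    (h₁.fields.lipBound_velocity (h₁.norm_meanControl_le hs hh hT) (ζ₂ s))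
  refine ⟨fun x => φ (x + h • w x), hφ.comp_euler ha hM hΛ hh hw hwΛ hwA, ?_⟩
  have e1 := abs_le.1 (h₁.abs_integral_sub_euler_le hφ ha hM hs hh hT (ζ₂ s) hw.continuous hwε)
  have e2 := abs_le.1 (h₂.abs_integral_sub_euler_le hφ ha hM hs hh hT (ζ₂ s) hw.continuous hwε)
  have h0 : chiDist (ζ₂ s) (ζ₂ s) = 0 := by
    simp [chiDist, W1_self (h₂.support_le s ⟨hs, by linarith⟩)]
  rw [h0, mul_zero] at e2
  linarith [e1.2, e2.1]

/-- The estimate obtained from finitely many backward Euler steps. -/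
theorem integral_sub_le_of_euler {ε A : ℝ} (hε : 0 ≤ ε) (hA : 0 ≤ A)
    (hmol : ∀ g : E d → E d, LipBound (L * (1 + d * U)) g → ∃ f : E d → E d, ContDiff ℝ ∞ f ∧
      (∀ x, ‖f x - g x‖ ≤ ε) ∧ LipBound (L * (1 + d * U)) f ∧ LipBound A (fderiv ℝ f))
    {S : ℝ} (hS : 0 ≤ S)
    (hle : ∀ s ∈ Set.Icc 0 T,
      chiDist (ζ₁ s) (ζ₂ s) ≤ S * Real.exp (3 * (L * (1 + d * U)) * s))
    {h α N : ℝ} (hh : 0 ≤ h) (hα : 0 ≤ α) (j : ℕ) :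
    j * h ≤ T → ∀ (a M : ℝ) (φ : E d → ℝ), 0 ≤ a → 0 ≤ M → TestFn a M φ →
      a * Real.exp (L * (1 + d * U) * (j * h)) ≤ α →
      Real.exp (2 * (L * (1 + d * U)) * (j * h)) * (M + j * h * (α * A)) ≤ N →
      ∫ x, φ x ∂(ζ₁ (j * h)).2.1 - ∫ x, φ x ∂(ζ₂ (j * h)).2.1 ≤
        a * (Real.exp (L * (1 + d * U) * (j * h)) * W1 (ζ₁ 0).2 (ζ₂ 0).2 +
          S / 2 * Real.exp (3 * (L * (1 + d * U)) * (j * h))) +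
        j * h * (2 * (α * ε + h * ((2 * (α * (L * (1 + d * U))) + N * (B * (1 + d * U))) *
          (U + B * (1 + d * U)) + N * (B * (1 + d * U) + ε) ^ 2))) := by
  have hU := h₁.U_nonneg
  have hB := h₁.fields.B_nonneg
  have hL := h₁.fields.L_nonneg
  have hW := W1_nonneg (ζ₁ 0).2 (ζ₂ 0).2
  set Λ := L * (1 + d * U) with hΛ
  set V := B * (1 + d * U) with hV
  set K := (2 * (α * Λ) + N * V) * (U + V) + N * (V + ε) ^ 2 with hK
  have hΛ0 : 0 ≤ Λ := by positivity
  have hV0 : 0 ≤ V := by positivity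
  -- Each step changes the test function and its constants, hence the quantification over `a`, `M`,
  -- `φ`. The numbers `α` and `N` dominate those constants along the whole backward iteration,
  -- making every consistency error at most the same multiple of `h`.
  induction j with
  | zero =>
    intro _ a M φ ha hM hφ _ _
    have h1 := (le_abs_self _).trans (hφ.lip.norm_integral_sub_le ha (ζ₁ 0).2 (ζ₂ 0).2)
    have h2 : 0 ≤ a * (S / 2) := by positivity
    simp only [Nat.cast_zero, zero_mul, mul_zero, Real.exp_zero, one_mul, mul_one, add_zero]
    linarith
  | succ j ih =>
    intro hT a M φ ha hM hφ haα hMN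
    push_cast at hT haα hMN ⊢
    set s := j * h with hs
    have hs0 : 0 ≤ s := by positivity
    have hsh : (j + 1) * h = s + h := by rw [hs]; ring
    rw [hsh] at hT haα hMN ⊢
    have hx : 1 + h * Λ ≤ Real.exp (Λ * h) := by linarith [Real.add_one_le_exp (Λ * h)]
    have hx3 : 1 + 3 * (h * Λ) ≤ Real.exp (3 * Λ * h) := by
      linarith [Real.add_one_le_exp (3 * Λ * h)]
    have hx2 : (1 + h * Λ) ^ 2 ≤ Real.exp (2 * Λ * h) := by
      calc (1 + h * Λ) ^ 2 ≤ Real.exp (Λ * h) ^ 2 := by gcongr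
        _ = Real.exp (2 * Λ * h) := by rw [← Real.exp_nat_mul]; congr 1; push_cast; ring
    have hs1 : 1 ≤ (1 + h * Λ) ^ 2 := one_le_pow₀ (by linarith [mul_nonneg hh hΛ0])
    have ex1 : Real.exp (Λ * (s + h)) = Real.exp (Λ * s) * Real.exp (Λ * h) := by
      rw [← Real.exp_add]; ring_nf
    have ex2 : Real.exp (2 * Λ * (s + h)) = Real.exp (2 * Λ * s) * Real.exp (2 * Λ * h) := by
      rw [← Real.exp_add]; ring_nf
    have ex3 : Real.exp (3 * Λ * (s + h)) = Real.exp (3 * Λ * s) * Real.exp (3 * Λ * h) := by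
      rw [← Real.exp_add]; ring_nf
    have haα' : a ≤ α := (le_mul_of_one_le_right ha
      (Real.one_le_exp (by positivity))).trans haα
    have hMN' : M ≤ N := by
      refine le_trans ?_ ((le_mul_of_one_le_left (by positivity)
        (Real.one_le_exp (by positivity))).trans hMN)
      have : 0 ≤ (s + h) * (α * A) := by positivity
      linarith
    obtain ⟨Φ, hΦ, hstep⟩ := exists_euler_step h₁ h₂ hmol hφ ha hM hs0 hh hT
    rw [← hΛ, ← hV] at hstep
    rw [← hΛ] at hΦ
    have hIH := ih (by linarith) _ _ Φ (by positivity) (by positivity) hΦ (by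
        refine le_trans ?_ haα
        rw [ex1]
        calc a * (1 + h * Λ) * Real.exp (Λ * s) ≤
              a * Real.exp (Λ * h) * Real.exp (Λ * s) := by gcongr
          _ = _ := by ring) (by
        refine le_trans ?_ hMN
        rw [ex2, mul_assoc (Real.exp _) (Real.exp _)]
        refine mul_le_mul_of_nonneg_left ?_ (Real.exp_nonneg _)
        have q1 : a * (h * A) ≤ α * (h * A) := by gcongr
        have q2 : h * (α * A) + s * (α * A) ≤
            (1 + h * Λ) ^ 2 * (h * (α * A) + s * (α * A)) :=
          le_mul_of_one_le_left (by positivity) hs1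
        calc M * (1 + h * Λ) ^ 2 + a * (h * A) + s * (α * A) ≤
              (1 + h * Λ) ^ 2 * (M + (s + h) * (α * A)) := by linarith
          _ ≤ Real.exp (2 * Λ * h) * (M + (s + h) * (α * A)) := by gcongr)
    have hD := hle s ⟨hs0, by linarith⟩
    set W := W1 (ζ₁ 0).2 (ζ₂ 0).2
    have k1 : a * h * Λ * chiDist (ζ₁ s) (ζ₂ s) ≤ a * h * Λ * (S * Real.exp (3 * Λ * s)) := by
      gcongr
    have k2 : a * h * ε + h ^ 2 * ((2 * (a * Λ) + M * V) * (U + V) + M * (V + ε) ^ 2) ≤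
        h * (α * ε + h * K) := by
      calc _ ≤ α * h * ε + h ^ 2 * ((2 * (α * Λ) + N * V) * (U + V) + N * (V + ε) ^ 2) := by
            gcongr
        _ = _ := by rw [hK]; ring
    have k3 : a * (1 + h * Λ) * (Real.exp (Λ * s) * W) ≤
        a * (Real.exp (Λ * (s + h)) * W) := by
      rw [ex1]
      calc _ ≤ a * Real.exp (Λ * h) * (Real.exp (Λ * s) * W) := by gcongr
        _ = _ := by ring
    -- The inherited term gives `1 + hΛ` and the new coupling term `a h Λ S` gives `2 hΛ` in units
    -- of `a S / 2`. Their sum `1 + 3 hΛ` dictates the exponent 3.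
    have k4 : a * (S / 2 * Real.exp (3 * Λ * s)) * (1 + 3 * (h * Λ)) ≤
        a * (S / 2 * Real.exp (3 * Λ * (s + h))) := by
      rw [ex3]
      calc _ ≤ a * (S / 2 * Real.exp (3 * Λ * s)) * Real.exp (3 * Λ * h) := by gcongr
        _ = _ := by ring
    linarith

/-- The improvement step of the stability estimate. -/
theorem chiDist_le_of_le {S : ℝ} (hS : 0 ≤ S)
    (hle : ∀ s ∈ Set.Icc 0 T,
      chiDist (ζ₁ s) (ζ₂ s) ≤ S * Real.exp (3 * (L * (1 + d * U)) * s)) {t : ℝ}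
    (ht : t ∈ Set.Icc 0 T) :
    chiDist (ζ₁ t) (ζ₂ t) ≤
      (chiDist (ζ₁ 0) (ζ₂ 0) + S / 2) * Real.exp (3 * (L * (1 + d * U)) * t) := by
  have hU := h₁.U_nonneg
  have hL := h₁.fields.L_nonneg
  have hW := W1_nonneg (ζ₁ 0).2 (ζ₂ 0).2
  have hΛ0 : 0 ≤ L * (1 + d * U) := by positivity
  have ht0 := ht.1
  have hWt : W1 (ζ₁ t).2 (ζ₂ t).2 ≤ Real.exp (L * (1 + d * U) * t) * W1 (ζ₁ 0).2 (ζ₂ 0).2 +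
      S / 2 * Real.exp (3 * (L * (1 + d * U)) * t) := by
    refine W1_le_of_forall_testFn (h₁.support_le t ht) (h₂.support_le t ht) fun φ M hM hφ =>
      le_of_forall_pos_le_add fun η hη => ?_
    set α := Real.exp (L * (1 + d * U) * t) with hα
    -- The width is chosen so that the total mollification error `2 t α ε` is at most `η`. It is
    -- fixed before the number of steps tends to infinity, so `A` and `N` stay constant in that
    -- limit.
    obtain ⟨A, hA, hmol⟩ := exists_mollification (X := E d) (F := E d) hΛ0
      (show 0 < η / (t * (2 * α) + 1) by positivity)
    set ε := η / (t * (2 * α) + 1) with hε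
    have hε0 : 0 ≤ ε := by positivity
    set N := Real.exp (2 * (L * (1 + d * U)) * t) * (M + t * (α * A))
    have key := fun n : ℕ => integral_sub_le_of_euler h₁ h₂ hε0 hA hmol hS hle
      (h := t / (n + 1)) (α := α) (N := N) (by positivity) (by positivity) (n + 1)
    have hn : ∀ n : ℕ, ((n + 1 : ℕ) : ℝ) * (t / (n + 1)) = t := fun n => by
      push_cast; field_simp
    simp only [hn] at key
    have key' := fun n : ℕ => key n ht.2 1 M φ zero_le_one hM hφ (by rw [one_mul]) le_rfl
    simp only [one_mul] at key'
    have hlim : ∀ c K : ℝ, Tendsto (fun n : ℕ => c + t * (2 * (α * ε + t / ((n : ℝ) + 1) * K)))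
        atTop (𝓝 (c + t * (2 * (α * ε + 0 * K)))) := fun c K => by
      have h0 : Tendsto (fun n : ℕ => t / ((n : ℝ) + 1)) atTop (𝓝 0) :=
        tendsto_const_nhds.div_atTop
          (tendsto_atTop_add_const_right _ _ tendsto_natCast_atTop_atTop)
      exact tendsto_const_nhds.add (((tendsto_const_nhds.add (h0.mul_const K)).const_mul
        2).const_mul t)
    refine (ge_of_tendsto' (hlim _ _) key').trans ?_
    have h3 : t * (2 * (α * ε)) ≤ η := by
      have : (t * (2 * α) + 1) * ε = η := by
        rw [hε, mul_div_cancel₀ _ (by positivity)]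
      linarith
    rw [zero_mul, add_zero]
    linarith
  -- Both solutions have the same control, so its integral cancels.
  have hlead : ∀ k, (ζ₁ t).1 k - (ζ₂ t).1 k = (ζ₁ 0).1 k - (ζ₂ 0).1 k := fun k => by
    rw [h₁.leaders t ht, h₂.leaders t ht, add_sub_add_right_eq_sub]
  have hmean : 0 ≤ (1 / (m : ℝ)) * ∑ k, ‖(ζ₁ 0).1 k - (ζ₂ 0).1 k‖ := by positivity
  have e1 : 1 ≤ Real.exp (3 * (L * (1 + d * U)) * t) := Real.one_le_exp (by positivity)
  have e2 : Real.exp (L * (1 + d * U) * t) ≤ Real.exp (3 * (L * (1 + d * U)) * t) :=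
    Real.exp_le_exp.2 (by nlinarith [mul_nonneg hΛ0 ht0])
  simp only [chiDist, hlead]
  nlinarith [mul_le_mul_of_nonneg_left e1 hmean, mul_le_mul_of_nonneg_right e2 hW]

/-- Stability of confined solutions. -/
theorem chiDist_le_exp {t : ℝ} (ht : t ∈ Set.Icc 0 T) :
    chiDist (ζ₁ t) (ζ₂ t) ≤
      2 * chiDist (ζ₁ 0) (ζ₂ 0) * Real.exp (3 * (L * (1 + d * U)) * t) := by
  have hU := h₁.U_nonneg
  have hL := h₁.fields.L_nonneg
  refine le_two_mul_of_improving (s := Set.Icc 0 T) (f := fun t => chiDist (ζ₁ t) (ζ₂ t))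
    (w := fun t => Real.exp (3 * (L * (1 + d * U)) * t))
    (S₀ := (1 / (m : ℝ)) * ∑ k, ‖(ζ₁ 0).1 k - (ζ₂ 0).1 k‖ + 2 * ρ)
    (fun t ht => Real.one_le_exp (mul_nonneg (by positivity) ht.1)) (chiDist_nonneg _ _)
    (fun t ht => ?_) (fun S hS hle t ht => chiDist_le_of_le h₁ h₂ hS hle ht) t ht
  have hlead : ∀ k, (ζ₁ t).1 k - (ζ₂ t).1 k = (ζ₁ 0).1 k - (ζ₂ 0).1 k := fun k => by
    rw [h₁.leaders t ht, h₂.leaders t ht, add_sub_add_right_eq_sub]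
  simp only [chiDist, hlead]
  linarith [W1_le_of_ae_norm_le (h₁.support_le t ht) (h₂.support_le t ht)]

end ConfinedSolution

end Stability

/-! ### Reduction to regular fields and the main theorem -/

section Main

variable {d m : ℕ}

theorem ae_norm_le_of_support_subset {μ : Measure (E d)} {R : ℝ}
    (h : μ.support ⊆ Metric.closedBall 0 R) : ∀ᵐ x ∂μ, ‖x‖ ≤ R := by
  filter_upwards [Measure.support_mem_ae (μ := μ)] with x hx
  simpa using h hx

theorem SublinearGrowth.exists_nonneg {F : E d → E d} (hF : SublinearGrowth F) :
    ∃ C, 0 ≤ C ∧ ∀ ξ, ‖F ξ‖ ≤ C * (1 + ‖ξ‖) := by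
  obtain ⟨C, hC⟩ := hF
  exact ⟨|C|, abs_nonneg C, fun ξ => (hC ξ).trans
    (mul_le_mul_of_nonneg_right (le_abs_self C) (by positivity))⟩

theorem exists_common_growth {H : E d → E d} {G : Fin d → E d → E d} (hH : SublinearGrowth H)
    (hG : ∀ ℓ, SublinearGrowth (G ℓ)) :
    ∃ C, 0 ≤ C ∧ (∀ ξ, ‖H ξ‖ ≤ C * (1 + ‖ξ‖)) ∧ ∀ ℓ ξ, ‖G ℓ ξ‖ ≤ C * (1 + ‖ξ‖) := by
  obtain ⟨C, hC, h1⟩ := hH.exists_nonneg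
  choose C' hC' h2 using fun ℓ => (hG ℓ).exists_nonneg
  have hs : ∀ ℓ, C' ℓ ≤ ∑ ℓ, C' ℓ := fun ℓ =>
    Finset.single_le_sum (fun i _ => hC' i) (Finset.mem_univ ℓ)
  have hs0 : 0 ≤ ∑ ℓ, C' ℓ := Finset.sum_nonneg fun i _ => hC' i
  refine ⟨C + ∑ ℓ, C' ℓ, by positivity, fun ξ => (h1 ξ).trans ?_, fun ℓ ξ => (h2 ℓ ξ).trans ?_⟩
  · gcongr; linarith
  · gcongr; linarith [hs ℓ]

theorem norm_comp_clamp_le {F : E d → E d} {C r : ℝ} (hC : 0 ≤ C) (hr : 0 ≤ r)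
    (hF : ∀ ξ, ‖F ξ‖ ≤ C * (1 + ‖ξ‖)) (ξ : E d) : ‖F (clamp r ξ)‖ ≤ C * (1 + ‖ξ‖) :=
  (hF _).trans (mul_le_mul_of_nonneg_left (by linarith [norm_clamp_le_norm hr ξ]) hC)

/-- Truncating the interaction fields far away does not change the velocity of a state that is
carried by a ball. -/
theorem velocity_comp_clamp {H : E d → E d} {G : Fin d → E d → E d} {u : Fin m → E d}
    {p : Chi d m} {ρ : ℝ} (hY : ∀ k, ‖p.1 k‖ ≤ ρ) (hμ : ∀ᵐ x ∂p.2.1, ‖x‖ ≤ ρ) {x : E d}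
    (hx : ‖x‖ ≤ ρ) :
    velocity (H ∘ clamp (2 * ρ)) (fun ℓ => G ℓ ∘ clamp (2 * ρ)) u p x = velocity H G u p x := by
  have hdiff : ∀ y : E d, ‖y‖ ≤ ρ → clamp (2 * ρ) (x - y) = x - y := fun y hy =>
    clamp_eq_self (by linarith [norm_sub_le x y])
  unfold velocity conv convLeaders
  congr 1
  · refine integral_congr_ae ?_
    filter_upwards [hμ] with y hy
    rw [Function.comp_apply, hdiff y hy]
  · simp only [Function.comp_apply, hdiff _ (hY _)]

/-- Once leaders and followers are known to stay in a ball, the original and the truncated equations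
coincide on the solution. -/
theorem IsSolution.confined {T ρ U B L : ℝ} {H : E d → E d} {G : Fin d → E d → E d}
    {u : ℝ → Fin m → E d} {p₀ : Chi d m} {ζ : ℝ → Chi d m} (h : IsSolution T H G u p₀ ζ)
    (hfields : RegularFields B L (H ∘ clamp (2 * ρ)) fun ℓ => G ℓ ∘ clamp (2 * ρ))
    (hρ : 0 ≤ ρ) (hU : 0 ≤ U) (hum : AEStronglyMeasurable u (volume.restrict (Set.Icc 0 T)))
    (hu : ∀ᵐ t ∂(volume.restrict (Set.Icc 0 T)), ‖u t‖ ≤ U)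
    (hY : ∀ t ∈ Set.Icc 0 T, ∀ k, ‖(ζ t).1 k‖ ≤ ρ)
    (hμ : ∀ t ∈ Set.Icc 0 T, ∀ᵐ x ∂(ζ t).2.1, ‖x‖ ≤ ρ) :
    ConfinedSolution T ρ U B L (H ∘ clamp (2 * ρ)) (fun ℓ => G ℓ ∘ clamp (2 * ρ)) u ζ where
  fields := hfields
  ρ_nonneg := hρ
  U_nonneg := hU
  measurable := hum
  control_le := hu
  support_le := hμ
  continuous := h.continuous
  leaders := h.leaders
  followers φ hφ hc t ht := by
    rw [h.followers φ hφ hc t ht]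
    congr 1
    refine intervalIntegral.integral_congr fun s hs => ?_
    rw [Set.uIcc_of_le ht.1] at hs
    have hsT : s ∈ Set.Icc 0 T := ⟨hs.1, hs.2.trans ht.2⟩
    refine integral_congr_ae ?_
    filter_upwards [hμ s hsT] with x hx
    rw [inner_gradient, velocity_comp_clamp (hY s hsT) (hμ s hsT) hx]

/-- All solutions starting in a given ball are confined by a common ball. -/
theorem exists_common_confinement {T R U : ℝ} (hT : 0 ≤ T) (hR : 0 ≤ R) (hU : 0 ≤ U)
    {H : E d → E d} {G : Fin d → E d → E d} (hH : LocallyLipschitz H)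
    (hHg : SublinearGrowth H) (hG : ∀ ℓ, LocallyLipschitz (G ℓ))
    (hGg : ∀ ℓ, SublinearGrowth (G ℓ)) :
    ∃ ρ B L : ℝ, 0 ≤ L ∧ ∀ (u : ℝ → Fin m → E d) (p₀ : Chi d m) (ζ : ℝ → Chi d m),
      AEStronglyMeasurable u (volume.restrict (Set.Icc 0 T)) →
      (∀ᵐ t ∂(volume.restrict (Set.Icc 0 T)), ‖u t‖ ≤ U) →
      (∀ k, ‖p₀.1 k‖ ≤ R) → (∀ᵐ x ∂p₀.2.1, ‖x‖ ≤ R) → IsSolution T H G u p₀ ζ →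
      ConfinedSolution T ρ U B L (H ∘ clamp (2 * ρ)) (fun ℓ => G ℓ ∘ clamp (2 * ρ)) u ζ := by
  obtain ⟨C, hC, hHC, hGC⟩ := exists_common_growth hHg hGg
  obtain ⟨ρ, hρ, hconf⟩ := ConfinedSolution.exists_confinement d hC hU hT hR
  obtain ⟨B, L, hBL⟩ := exists_regularFields hH hG (r := 2 * ρ) (by positivity)
  refine ⟨ρ, B, L, hBL.L_nonneg, fun u p₀ ζ hum hu hY hμ hζ => ?_⟩
  obtain ⟨R', hR', hsupp⟩ := hζ.equicompact
  have hUi : IntegrableOn u (Set.Icc 0 T) := Integrable.of_bound hum U hu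
  set r := max R' (R + U * T) with hr
  have hr0 : 0 ≤ r := hR'.le.trans (le_max_left _ _)
  have hlead : ∀ t ∈ Set.Icc 0 T, ∀ k, ‖(ζ t).1 k‖ ≤ r := fun t ht k => by
    refine le_trans ?_ (le_max_right _ _)
    rw [hζ.leaders t ht k, hζ.initial]
    refine (norm_add_le _ _).trans (add_le_add (hY k) ?_)
    have h1 : ‖∫ s in (0 : ℝ)..t, u s k‖ ≤ U * |t - 0| := by
      refine intervalIntegral.norm_integral_le_of_norm_le_const_ae (f := fun s => u s k) ?_
      filter_upwards [ae_uIoc_of_ae_Icc hu le_rfl ht.1 ht.2] with s hs hst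
      exact (norm_le_pi_norm (u s) k).trans (hs hst)
    rw [sub_zero, abs_of_nonneg ht.1] at h1
    exact h1.trans (mul_le_mul_of_nonneg_left ht.2 hU)
  have hball : ∀ t ∈ Set.Icc 0 T, ∀ᵐ x ∂(ζ t).2.1, ‖x‖ ≤ r := fun t ht => by
    filter_upwards [ae_norm_le_of_support_subset (hsupp t ht)] with x hx
    exact hx.trans (le_max_left _ _)
  -- The first truncation is at the solution's own radius, on which no uniform control is available
  -- yet. The moment estimate then gives the common radius `ρ`, and the original fields are
  -- truncated again at that scale.
  obtain ⟨B', L', hBL'⟩ := exists_regularFields hH hG (r := 2 * r) (by positivity)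
  have hζ' := hζ.confined hBL' hr0 hU hum hu hlead hball
  have hfin := hconf hζ' (norm_comp_clamp_le hC (by positivity) hHC)
    (fun ℓ => norm_comp_clamp_le hC (by positivity) (hGC ℓ)) (by rwa [hζ.initial])
    (by rwa [hζ.initial])
  exact hζ.confined hBL hρ hU hum hu (fun t ht => (hfin t ht).1) fun t ht => (hfin t ht).2

end Main

end LeaderFollower

end

theorem mainTheorem5 {d m : ℕ} (T : ℝ) (hT : 0 < T)
    (H : LeaderFollower.E d → LeaderFollower.E d)
    (G : Fin d → LeaderFollower.E d → LeaderFollower.E d)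
    (hH : LocallyLipschitz H) (hHgrowth : LeaderFollower.SublinearGrowth H)
    (hG : ∀ ℓ, LocallyLipschitz (G ℓ)) (hGgrowth : ∀ ℓ, LeaderFollower.SublinearGrowth (G ℓ))
    (𝒰 : Set (Fin m → LeaderFollower.E d)) (h𝒰 : IsCompact 𝒰) (h𝒰ne : 𝒰.Nonempty)
    (R : ℝ) :
    ∃ C_T : ℝ, 0 < C_T ∧
      ∀ u : ℝ → Fin m → LeaderFollower.E d, LeaderFollower.IsControl T 𝒰 u →
      ∀ p₁ p₂ : LeaderFollower.Chi d m,
        (∀ k, ‖p₁.1 k‖ ≤ R) → (∀ k, ‖p₂.1 k‖ ≤ R) →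
        p₁.2.1.support ⊆ Metric.closedBall 0 R → p₂.2.1.support ⊆ Metric.closedBall 0 R →
      ∀ ζ₁ ζ₂ : ℝ → LeaderFollower.Chi d m,
        LeaderFollower.IsSolution T H G u p₁ ζ₁ → LeaderFollower.IsSolution T H G u p₂ ζ₂ →
        ∀ t ∈ Set.Icc 0 T,
          LeaderFollower.chiDist (ζ₁ t) (ζ₂ t) ≤ C_T * LeaderFollower.chiDist p₁ p₂ := by
  obtain ⟨U, hU⟩ := h𝒰.isBounded.exists_norm_le
  have hU0 : 0 ≤ U := (norm_nonneg _).trans (hU _ h𝒰ne.some_mem)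
  -- The sign of `R` is unrestricted, whereas confinement needs a nonnegative radius; hence `|R|`.
  obtain ⟨ρ, B, L, hL, hconf⟩ := LeaderFollower.exists_common_confinement (m := m) hT.le
    (abs_nonneg R) hU0 hH hHgrowth hG hGgrowth
  refine ⟨2 * Real.exp (3 * (L * (1 + d * U)) * T), by positivity, ?_⟩
  intro u hu p₁ p₂ hY₁ hY₂ hμ₁ hμ₂ ζ₁ ζ₂ hζ₁ hζ₂ t ht
  have hub : ∀ᵐ t ∂(MeasureTheory.volume.restrict (Set.Icc 0 T)), ‖u t‖ ≤ U := by
    filter_upwards [hu.2] with t ht using hU _ ht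
  have hle : ∀ {x : ℝ}, x ≤ R → x ≤ |R| := fun hx => hx.trans (le_abs_self R)
  have c₁ := hconf u p₁ ζ₁ hu.1.1 hub (fun k => hle (hY₁ k))
    ((LeaderFollower.ae_norm_le_of_support_subset hμ₁).mono fun _ hx => hle hx) hζ₁
  have c₂ := hconf u p₂ ζ₂ hu.1.1 hub (fun k => hle (hY₂ k))
    ((LeaderFollower.ae_norm_le_of_support_subset hμ₂).mono fun _ hx => hle hx) hζ₂
  have hmain := c₁.chiDist_le_exp c₂ ht
  rw [hζ₁.initial, hζ₂.initial] at hmain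
  have hexp : Real.exp (3 * (L * (1 + d * U)) * t) ≤ Real.exp (3 * (L * (1 + d * U)) * T) := by
    gcongr
    exact ht.2
  calc _ ≤ _ := hmain
    _ ≤ 2 * LeaderFollower.chiDist p₁ p₂ * Real.exp (3 * (L * (1 + d * U)) * T) :=
      mul_le_mul_of_nonneg_left hexp
        (mul_nonneg zero_le_two (LeaderFollower.chiDist_nonneg p₁ p₂))
    _ = _ := by ring
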